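/- Let $T>0$, let $\nu$ be a probability measure on $\mathbb R^d$ with $\nu(\{0\})=0$, and let $M_T$ be the space of right-continuous functions $\omega:[0,T]\to\mathbb R^d$ with left limits, with the $\sigma$-algebra generated by the coordinate maps (the Borel $\sigma$-algebra of the Skorokhod topology). Let $X=(X_t)_{0\le t\le T}$ be a Poisson process on $\mathbb R^d$ with $X_0=0$ and intensity $\nu$: a process with paths in $M_T$ and independent increments such that, for $s\le t$, $X_t-X_s$ has the compound Poisson law $\sum_{n\ge0}e^{-(t-s)}\frac{(t-s)^n}{n!}\nu^{*n}$. Let $\mu$ be the law of $X$ on $M_T$. Let $\tau$ be uniform on $[0,T]$ and $\xi$ have law $\nu$, with $X,\tau,\xi$ independent. For $\omega\in M_T$ let $N_T(\omega)$ be the number of $t\in[0,T]$ with $\omega_t\ne\omega_{t-}$ and, for $x\in\mathbb R^d\setminus\{0\}$, let $N^{(x)}_T(\omega)$ be the number of $t\in[0,T]$ with $\omega_t-\omega_{t-}=x$ (with $\omega_{0-}:=\omega_0$). For measurable $F,G:M_T\to\mathbb R$ put $$\Gamma_{t,x}(F,G)(\omega)=\big(F(\omega+x1_{[t,T]})-F(\omega)\big)\big(G(\omega+x1_{[t,T]})-G(\omega)\big),$$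 $$\mathcal E(F,G)=\frac1T\int_{M_T}\mu(d\omega)\int_0^Tdt\int_{\mathbb R^d}\Gamma_{t,x}(F,G)(\omega)\,\nu(dx),\qquad \mathcal D(\mathcal E)=\{F\in L^2(M_T;\mu):\mathcal E(F,F)<\infty\}.$$ (1) $\mu$ is quasi-invariant under the random shift $\omega\mapsto\omega+\xi1_{[\tau,T]}$, in the sense that the law $\tilde\mu$ of $X+\xi1_{[\tau,T]}$ is absolutely continuous with respect to $\mu$, with density $$\frac{d\tilde\mu}{d\mu}(\omega)=\frac{N_T(\omega)}{T}.$$ (2) $\mathcal E(F,F)\in[0,\infty]$ and, for $F,G\in\mathcal D(\mathcal E)$, $\mathcal E(F,G)$ (whose defining integral then converges absolutely) do not depend on the $\mu$-versions of $F,G$, and $(\mathcal E,\mathcal D(\mathcal E))$ is a symmetric Dirichlet form on $L^2(M_T;\mu)$ (a densely defined, nonnegative, symmetric, closed bilinear form such that $F\in\mathcal D(\mathcal E)$ implies $F^+\wedge1\in\mathcal D(\mathcal E)$ and $\mathcal E(F^+\wedge1,F^+\wedge1)\le\mathcal E(F,F)$), which is conservative: $1\in\mathcal D(\mathcal E)$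 and $\mathcal E(1,G)=0$ for all $G\in\mathcal D(\mathcal E)$. (3) Let $(L,\mathcal D(L))$ be the generator of $(\mathcal E,\mathcal D(\mathcal E))$, that is, $F\in\mathcal D(L)$ and $LF=H$ if and only if $F\in\mathcal D(\mathcal E)$, $H\in L^2(M_T;\mu)$ and $\mathcal E(F,G)=-\int GH\,d\mu$ for all $G\in\mathcal D(\mathcal E)$. Then $\mathcal D(L)$ contains every bounded measurable function $F$ on $M_T$. If $\pi_x(\omega,dt)$ is any regular conditional distribution of $\tau$ given $X+x1_{[\tau,T]}$, jointly measurable in $(x,\omega)$ (that is, a regular conditional distribution of $\tau$ given $\xi=x$ and $X+\xi1_{[\tau,T]}=\omega$), then for such $F$ and $\mu$-almost every $\omega$ $$LF(\omega)=\frac1T\int_0^T\!\!dt\int_{\mathbb R^d}\big(F(\omega+x1_{[t,T]})-F(\omega)\big)\nu(dx)+\sum_{x\in\mathbb R^d\setminus\{0\}}\frac{N^{(x)}_T(\omega)}{T}\int\big(F(\omega-x1_{[t,T]})-F(\omega)\big)\pi_x(\omega,dt),$$ where the sum over $x$ converges absolutely. In particular, if $\nu$ is supported on $\mathbb Z^d$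 and, for each $k\in\mathbb Z^d$, $\pi_k$ is any regular conditional distribution of $\tau$ given $X+k1_{[\tau,T]}$, then for such $F$ and $\mu$-almost every $\omega$ $$LF(\omega)=\sum_{k\in\mathbb Z^d}\frac{\nu(\{k\})}{T}\int_0^T\big(F(\omega+k1_{[t,T]})-F(\omega)\big)dt+\sum_{k\in\mathbb Z^d\setminus\{0\}}\frac{N_T^{(k)}(\omega)}{T}\int\big(F(\omega-k1_{[t,T]})-F(\omega)\big)\pi_k(\omega,dt),$$ with both sums absolutely convergent. -/

import Mathlib

open MeasureTheory ProbabilityTheory Set Filter Topology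
open scoped ENNReal NNReal

noncomputable section

/-- `ℝ^d` with its Euclidean norm. -/
abbrev Rd (d : ℕ) : Type := EuclideanSpace ℝ (Fin d)

/-- Right continuous functions on `[0,T]` having left limits. (At `t = 0` the filter `𝓝[<] t` of
the space `[0,T]` is trivial, and so is `𝓝[>] t` at `t = T`, so nothing is required there.) -/
def IsCadlag {T : ℝ} {d : ℕ} (w : Icc (0 : ℝ) T → Rd d) : Prop :=
  ∀ t, ContinuousWithinAt w (Ici t) t ∧ ∃ l, Tendsto w (𝓝[<] t) (𝓝 l)

/-- The path space `M_T`. As a subtype of `[0,T] → ℝ^d` it carries the σ-algebra generated by the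
coordinate maps `ω ↦ ω_t`, which is the Borel σ-algebra of the Skorokhod topology. -/
abbrev PathSpace (T : ℝ) (d : ℕ) : Type := {w : Icc (0 : ℝ) T → Rd d // IsCadlag w}

/-- A single step of height `x` at time `t` is right continuous with left limits. -/
theorem isCadlag_add_step {T : ℝ} {d : ℕ} {w : Icc (0 : ℝ) T → Rd d} (hw : IsCadlag w)
    (x : Rd d) (t : ℝ) : IsCadlag (fun s => w s + if t ≤ (s : ℝ) then x else 0) := by
  intro s
  obtain ⟨hr, l, hl⟩ := hw s
  have hc : Continuous (fun r : Icc (0 : ℝ) T => (r : ℝ)) := continuous_subtype_val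
  constructor
  · refine hr.add ?_
    by_cases h : t ≤ (s : ℝ)
    · refine (continuousWithinAt_const (b := x)).congr_of_eventuallyEq ?_ (by simp [h])
      filter_upwards [self_mem_nhdsWithin] with r hsr
      have : (s : ℝ) ≤ r := hsr
      simp [h.trans this]
    · refine (continuousWithinAt_const (b := (0 : Rd d))).congr_of_eventuallyEq ?_ (by simp [h])
      filter_upwards [mem_nhdsWithin_of_mem_nhds
        (hc.continuousAt.eventually_lt continuousAt_const (not_le.mp h))] with r hr
      simp [not_le.mpr hr]
  · by_cases h : t < (s : ℝ)
    · refine ⟨l + x, hl.add ((tendsto_const_nhds (x := x)).congr' ?_)⟩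
      filter_upwards [mem_nhdsWithin_of_mem_nhds
        (continuousAt_const.eventually_lt hc.continuousAt h)] with r hr
      simp [hr.le]
    · refine ⟨l + 0, hl.add ((tendsto_const_nhds (x := (0 : Rd d))).congr' ?_)⟩
      filter_upwards [self_mem_nhdsWithin] with r hr
      have h1 : (r : ℝ) < s := hr
      simp [not_le.mpr (h1.trans_le (not_lt.mp h))]

/-- The shifted path `ω + x 1_{[t,T]}`. -/
def shift {T : ℝ} {d : ℕ} (w : PathSpace T d) (x : Rd d) (t : ℝ) : PathSpace T d :=
  ⟨fun s => w.1 s + if t ≤ (s : ℝ) then x else 0, isCadlag_add_step w.2 x t⟩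

/-- `N_T(ω)`, the number of `t ∈ [0,T]` with `ω_t ≠ ω_{t-}` (where `ω_{0-} = ω_0`). -/
def jumpCount {T : ℝ} {d : ℕ} (w : PathSpace T d) : ℝ≥0∞ :=
  (({t | w.1 t ≠ Function.leftLim w.1 t} : Set (Icc (0 : ℝ) T)).encard : ℝ≥0∞)

/-- `N_T^{(x)}(ω)`, the number of `t ∈ [0,T]` with `ω_t - ω_{t-} = x`. -/
def jumpCountOf {T : ℝ} {d : ℕ} (x : Rd d) (w : PathSpace T d) : ℝ≥0∞ :=
  (({t | w.1 t - Function.leftLim w.1 t = x} : Set (Icc (0 : ℝ) T)).encard : ℝ≥0∞)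

/-- The compound Poisson law with total rate `r` and jump law `ν`: the law of a sum of `n`
independent variables of law `ν`, where `n` is an independent Poisson variable of mean `r`. -/
def compoundPoisson {d : ℕ} (r : ℝ≥0) (ν : Measure (Rd d)) : Measure (Rd d) :=
  Measure.sum fun n : ℕ =>
    poissonMeasure r {n} • (Measure.pi fun _ : Fin n => ν).map (fun y => ∑ i, y i)

/-- `X` is a Poisson process on `ℝ^d` over `[0,T]` with `X_0 = 0` and intensity `ν`: a process with
càdlàg paths and independent increments, where `X_t - X_s` is compound Poisson with total rate
`t - s` and jump law `ν`. -/
structure IsPoissonProcess {Ω : Type*} [MeasurableSpace Ω] {T : ℝ} {d : ℕ}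
    (X : Ω → PathSpace T d) (ν : Measure (Rd d)) (P : Measure Ω) : Prop where
  measurable : Measurable X
  start : ∀ t : Icc (0 : ℝ) T, (t : ℝ) = 0 → ∀ᵐ a ∂P, (X a).1 t = 0
  indep : HasIndepIncrements (fun (t : Icc (0 : ℝ) T) a => (X a).1 t) P
  law : ∀ s t : Icc (0 : ℝ) T, s ≤ t →
    P.map (fun a => (X a).1 t - (X a).1 s) = compoundPoisson (Real.toNNReal (t - s)) ν

/-- `Γ_{t,x}(F,G)`. -/
def Gam {T : ℝ} {d : ℕ} (t : ℝ) (x : Rd d) (F G : PathSpace T d → ℝ) (w : PathSpace T d) : ℝ :=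
  (F (shift w x t) - F w) * (G (shift w x t) - G w)

/-- `ℰ(F,F)` as an element of `[0,∞]`. -/
def energy {T : ℝ} {d : ℕ} (ν : Measure (Rd d)) (μ : Measure (PathSpace T d))
    (F : PathSpace T d → ℝ) : ℝ≥0∞ :=
  (ENNReal.ofReal T)⁻¹ *
    ∫⁻ w, ∫⁻ t in Icc (0 : ℝ) T, ∫⁻ x, ENNReal.ofReal (Gam t x F F w) ∂ν ∂volume ∂μ

/-- `ℰ(F,G)`. -/
def jumpForm {T : ℝ} {d : ℕ} (ν : Measure (Rd d)) (μ : Measure (PathSpace T d))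
    (F G : PathSpace T d → ℝ) : ℝ :=
  T⁻¹ * ∫ w, ∫ t in Icc (0 : ℝ) T, ∫ x, Gam t x F G w ∂ν ∂volume ∂μ

/-- `𝒟(ℰ) = {F ∈ L²(μ) : ℰ(F,F) < ∞}`. -/
def jumpDomain {T : ℝ} {d : ℕ} (ν : Measure (Rd d)) (μ : Measure (PathSpace T d)) :
    Set (Lp ℝ 2 μ) :=
  {F | energy ν μ F < ∞}

/-- `ℰ` as a form on (classes in) `L²(μ)`. -/
def jumpFormL2 {T : ℝ} {d : ℕ} (ν : Measure (Rd d)) (μ : Measure (PathSpace T d))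
    (F G : Lp ℝ 2 μ) : ℝ :=
  jumpForm ν μ F G

/-- `(E, D)` is a symmetric Dirichlet form on `L²(μ)`: a densely defined, nonnegative symmetric
bilinear form, closed (`D` is complete for `E(F,F) + ‖F‖²`), on which the unit contraction
`F ↦ (F ∨ 0) ∧ 1` operates. Only the values of `E` on `D × D` matter. -/
structure IsSymmetricDirichletForm {S : Type*} [MeasurableSpace S] (μ : Measure S)
    (D : Set (Lp ℝ 2 μ)) (E : Lp ℝ 2 μ → Lp ℝ 2 μ → ℝ) : Prop where
  zero_mem : 0 ∈ D
  add_mem : ∀ F ∈ D, ∀ G ∈ D, F + G ∈ D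
  smul_mem : ∀ c : ℝ, ∀ F ∈ D, c • F ∈ D
  dense : Dense D
  symm : ∀ F ∈ D, ∀ G ∈ D, E F G = E G F
  add_left : ∀ F ∈ D, ∀ G ∈ D, ∀ H ∈ D, E (F + G) H = E F H + E G H
  smul_left : ∀ c : ℝ, ∀ F ∈ D, ∀ G ∈ D, E (c • F) G = c * E F G
  nonneg : ∀ F ∈ D, 0 ≤ E F F
  closed : ∀ u : ℕ → Lp ℝ 2 μ, (∀ n, u n ∈ D) →
    (∀ ε > 0, ∃ N, ∀ m ≥ N, ∀ n ≥ N, E (u m - u n) (u m - u n) + ‖u m - u n‖ ^ 2 < ε) →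
    ∃ F ∈ D, Tendsto (fun n => E (u n - F) (u n - F) + ‖u n - F‖ ^ 2) atTop (𝓝 0)
  markov : ∀ F ∈ D, ∀ G : Lp ℝ 2 μ, (∀ᵐ w ∂μ, G w = min (max (F w) 0) 1) →
    G ∈ D ∧ E G G ≤ E F F

/-- The form is conservative: `1 ∈ D` and `E(1,G) = 0` for all `G ∈ D`. -/
def IsConservativeForm {S : Type*} [MeasurableSpace S] (μ : Measure S)
    (D : Set (Lp ℝ 2 μ)) (E : Lp ℝ 2 μ → Lp ℝ 2 μ → ℝ) : Prop :=
  ∃ I ∈ D, (∀ᵐ w ∂μ, I w = 1) ∧ ∀ G ∈ D, E I G = 0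

/-- The domain of the generator of `(E, D)`: all `F ∈ D` for which there is `H ∈ L²(μ)` with
`E(F,G) = -⟨H,G⟩` for all `G ∈ D`. -/
def generatorDomain {S : Type*} [MeasurableSpace S] (μ : Measure S)
    (D : Set (Lp ℝ 2 μ)) (E : Lp ℝ 2 μ → Lp ℝ 2 μ → ℝ) : Set (Lp ℝ 2 μ) :=
  {F | F ∈ D ∧ ∃ H : Lp ℝ 2 μ, ∀ G ∈ D, E F G = -inner ℝ H G}

open Classical in
/-- The generator of `(E, D)`: on its domain, `L F` is the element `H` with `E(F,G) = -⟨H,G⟩` for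
all `G ∈ D`, unique as soon as `D` is dense. (It is given the value `0` off its domain.) -/
def generator {S : Type*} [MeasurableSpace S] (μ : Measure S)
    (D : Set (Lp ℝ 2 μ)) (E : Lp ℝ 2 μ → Lp ℝ 2 μ → ℝ) (F : Lp ℝ 2 μ) : Lp ℝ 2 μ :=
  if h : F ∈ generatorDomain μ D E then h.2.choose else 0

/-- An integer vector as an element of `ℝ^d`. -/
def intVec {d : ℕ} (k : Fin d → ℤ) : Rd d := WithLp.toLp 2 fun i => (k i : ℝ)

end

/-! The theorem rests on an explicit description of `μ` and on one integral identity. A Poisson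
process on `[0,T]` has the law `stepMeasure`: draw a Poisson number `n` of mean `T`, then `n`
independent pairs (uniform time, jump of law `ν`), and add up the steps.
`map_increments_stepMeasure` computes the characteristic function of the increments of this law, and
`ext_of_map_increments` shows that a law of càdlàg paths starting at `0` is determined by its
increments.

Adding an independent pair `(τ, ξ)` to a configuration of `n` pairs gives a configuration of `n + 1`
pairs in which one is marked. Since `p (n + 1) * (n + 1) = T * p n` for the Poisson weights `p`,
this yields Mecke's formula `lintegral_jumpSum`: the expected sum of `f (x, ω)` over the jumps `x`
of `ω` equals the integral of `f (x, ω + x 1_{[t,T]})` against `μ(dω) dt ν(dx)`. When `f` depends on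
the path alone, the left side is the integral of `N_T f`; this is the density `N_T / T`, and in
particular the random shift is nonsingular.

Nonsingularity makes the difference operator `shiftDiff` well defined on classes, with a closed
graph from `L²(μ)` to `L²` of the reference measure. The form is `T⁻¹` times the inner product of
differences, so closedness comes from completeness and the Markov property from the fact that
clipping to `[0,1]` is 1-Lipschitz.

For the generator, `ℰ(F,G)` is split into a term with `G` at the original path and one with `G` at
the shifted path. The first gives the part of `L` that adds jumps. In the second, conditioning `τ`
on the shift size and the shifted path and then applying Mecke's formula gives the part that removes
jumps. `N_T` has a finite second moment, which puts the result in `L²`. For `ν` carried by `ℤ^d`,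
the conditional laws for the separate `k` are glued into one kernel. -/

noncomputable section

/-! ### Step paths and their jumps -/

section StepPath

variable {T : ℝ} {d n : ℕ}

theorem isCadlag_sum_step (T : ℝ) (s : Finset (Fin n)) (c : Fin n → ℝ × Rd d) :
    IsCadlag (T := T) (fun r => ∑ i ∈ s, if (c i).1 ≤ (r : ℝ) then (c i).2 else 0) := by
  classical
  induction s using Finset.induction_on with
  | empty => exact fun t => ⟨by simpa using continuousWithinAt_const, 0, by
      simpa using tendsto_const_nhds⟩
  | insert i s hi ih =>
    simp only [Finset.sum_insert hi]
    simpa only [add_comm] using isCadlag_add_step ih (c i).2 (c i).1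

/-- The step path `∑ i, x i • 1_{[t i, T]}` for the configuration `c i = (t i, x i)`. -/
def stepPath (T : ℝ) (c : Fin n → ℝ × Rd d) : PathSpace T d :=
  ⟨fun s => ∑ i, if (c i).1 ≤ (s : ℝ) then (c i).2 else 0, isCadlag_sum_step T Finset.univ c⟩

theorem stepPath_apply (c : Fin n → ℝ × Rd d) (s : Icc (0 : ℝ) T) :
    (stepPath T c).1 s = ∑ i, if (c i).1 ≤ (s : ℝ) then (c i).2 else 0 := rfl

theorem shift_apply (w : PathSpace T d) (x : Rd d) (t : ℝ) (s : Icc (0 : ℝ) T) :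
    (shift w x t).1 s = w.1 s + if t ≤ (s : ℝ) then x else 0 := rfl

@[simp]
theorem shift_shift_neg (w : PathSpace T d) (x : Rd d) (t : ℝ) :
    shift (shift w x t) (-x) t = w := by
  refine Subtype.ext (funext fun s => ?_)
  by_cases h : t ≤ (s : ℝ) <;> simp [shift_apply, h]

/-- Any of the jumps, not just the last, can play the role of the one added by the shift; this is
the algebraic core of Mecke's formula. -/
theorem stepPath_eq_shift (c : Fin (n + 1) → ℝ × Rd d) (i : Fin (n + 1)) :
    stepPath T c = shift (stepPath T fun j => c (i.succAbove j)) (c i).2 (c i).1 := by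
  refine Subtype.ext (funext fun s => ?_)
  rw [shift_apply, stepPath_apply, stepPath_apply, Fin.sum_univ_succAbove _ i, add_comm]

theorem stepPath_comp_perm (c : Fin n → ℝ × Rd d) (e : Equiv.Perm (Fin n)) :
    stepPath T (c ∘ e) = stepPath T c := by
  refine Subtype.ext (funext fun s => ?_)
  exact Equiv.sum_comp e fun i => if (c i).1 ≤ (s : ℝ) then (c i).2 else 0

theorem leftLim_stepPath {c : Fin n → ℝ × Rd d} (hc : ∀ i, 0 < (c i).1) (s : Icc (0 : ℝ) T) :
    Function.leftLim (stepPath T c).1 s = ∑ i, if (c i).1 < (s : ℝ) then (c i).2 else 0 := by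
  rcases eq_or_ne (𝓝[<] s) ⊥ with h | h
  · have hs : (s : ℝ) = 0 := by
      by_contra hs
      have h0 : (0 : ℝ) < s := lt_of_le_of_ne s.2.1 (Ne.symm hs)
      have hlt : (⟨0, le_rfl, s.2.1.trans s.2.2⟩ : Icc (0 : ℝ) T) < s := h0
      exact (nhdsLT_neBot_of_exists_lt ⟨_, hlt⟩).ne h
    -- At time `0` the left limit is by convention the value itself; since all jump times are
    -- positive, both sums vanish there.
    rw [leftLim_eq_of_eq_bot _ h, stepPath_apply]
    refine Finset.sum_congr rfl fun i _ => ?_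
    rw [hs, if_neg (not_le.2 (hc i)), if_neg (not_lt.2 (hc i).le)]
  · have hb : (𝓝[<] s).NeBot := ⟨h⟩
    refine leftLim_eq_of_tendsto (tendsto_const_nhds.congr' ?_)
    have hev : ∀ i, ∀ᶠ r : Icc (0 : ℝ) T in 𝓝[<] s, (c i).1 < (s : ℝ) → (c i).1 ≤ (r : ℝ) := by
      intro i
      by_cases hi : (c i).1 < (s : ℝ)
      · filter_upwards [mem_nhdsWithin_of_mem_nhds
          (continuousAt_const.eventually_lt continuous_subtype_val.continuousAt hi)] with r hr _
        exact hr.le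
      · exact Eventually.of_forall fun r h => absurd h hi
    filter_upwards [eventually_all.2 hev, self_mem_nhdsWithin] with r hr hrs
    have hrs' : (r : ℝ) < s := hrs
    rw [stepPath_apply]
    refine Finset.sum_congr rfl fun i _ => ?_
    by_cases hi : (c i).1 < (s : ℝ)
    · rw [if_pos hi, if_pos (hr i hi)]
    · rw [if_neg hi, if_neg (not_le.2 (hrs'.trans_le (not_lt.1 hi)))]

/-- Configurations with distinct jump times in `(0,T]` and nonzero jumps. -/
structure IsSimpleConfig (T : ℝ) (c : Fin n → ℝ × Rd d) : Prop where
  injective : Function.Injective fun i => (c i).1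
  mem : ∀ i, (c i).1 ∈ Ioc 0 T
  ne_zero : ∀ i, (c i).2 ≠ 0

namespace IsSimpleConfig

variable {c : Fin n → ℝ × Rd d}

/-- The jump times as elements of `[0,T]`. -/
def time (hc : IsSimpleConfig T c) (i : Fin n) : Icc (0 : ℝ) T :=
  ⟨(c i).1, (hc.mem i).1.le, (hc.mem i).2⟩

theorem time_injective (hc : IsSimpleConfig T c) : Function.Injective hc.time :=
  fun _ _ h => hc.injective (congrArg Subtype.val h)

theorem jump_eq (hc : IsSimpleConfig T c) (s : Icc (0 : ℝ) T) :
    (stepPath T c).1 s - Function.leftLim (stepPath T c).1 s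
      = ∑ i, if hc.time i = s then (c i).2 else 0 := by
  rw [leftLim_stepPath fun i => (hc.mem i).1, stepPath_apply, ← Finset.sum_sub_distrib]
  refine Finset.sum_congr rfl fun i _ => ?_
  have h : hc.time i = s ↔ (c i).1 = (s : ℝ) := Subtype.ext_iff
  rw [if_congr h rfl rfl]
  rcases lt_trichotomy (c i).1 (s : ℝ) with h | h | h
  · simp [h, h.le, h.ne]
  · simp [h]
  · simp [h.not_ge, h.not_gt, h.ne']

theorem jump_time (hc : IsSimpleConfig T c) (i : Fin n) :
    (stepPath T c).1 (hc.time i) - Function.leftLim (stepPath T c).1 (hc.time i) = (c i).2 := by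
  rw [hc.jump_eq, Finset.sum_eq_single i]
  · simp
  · exact fun j _ hj => if_neg fun h => hj (hc.time_injective h)
  · simp

theorem jump_of_notMem (hc : IsSimpleConfig T c) {s : Icc (0 : ℝ) T} (hs : s ∉ range hc.time) :
    (stepPath T c).1 s - Function.leftLim (stepPath T c).1 s = 0 := by
  rw [hc.jump_eq]
  exact Finset.sum_eq_zero fun i _ => if_neg fun h => hs ⟨i, h⟩

theorem jumpTimes_eq (hc : IsSimpleConfig T c) :
    {s | (stepPath T c).1 s ≠ Function.leftLim (stepPath T c).1 s} = range hc.time := by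
  ext s
  rw [mem_ofPred_eq, ← sub_ne_zero]
  constructor
  · intro h
    by_contra hs
    exact h (hc.jump_of_notMem hs)
  · rintro ⟨i, rfl⟩
    rw [hc.jump_time]
    exact hc.ne_zero i

theorem jumpCount_eq (hc : IsSimpleConfig T c) : jumpCount (stepPath T c) = n := by
  rw [jumpCount, hc.jumpTimes_eq, ← image_univ, hc.time_injective.encard_image, encard_univ]
  simp

/-- For `x = 0` the count is infinite and `toReal` sends it to `0`, which agrees with the right side
because no jump vanishes. Sums over jumps may therefore run over all of `ℝ^d` without excluding `0`.
-/
theorem jumpCountOf_toReal (hT : 0 < T) (hc : IsSimpleConfig T c) (x : Rd d) :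
    (jumpCountOf x (stepPath T c)).toReal = ∑ i, if (c i).2 = x then 1 else 0 := by
  classical
  rcases eq_or_ne x 0 with rfl | hx
  · have hinf : {s : Icc (0 : ℝ) T | (stepPath T c).1 s
        - Function.leftLim (stepPath T c).1 s = 0}.Infinite := by
      have : Infinite (Icc (0 : ℝ) T) := (Icc_infinite hT).to_subtype
      have h := (finite_range hc.time).infinite_compl
      exact h.mono fun s hs => hc.jump_of_notMem hs
    rw [jumpCountOf, hinf.encard_eq, Finset.sum_eq_zero fun i _ => if_neg (hc.ne_zero i)]
    simp
  · have h : {s : Icc (0 : ℝ) T | (stepPath T c).1 s - Function.leftLim (stepPath T c).1 s = x}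
        = hc.time '' {i | (c i).2 = x} := by
      ext s
      constructor
      · intro hs
        have hs' : s ∈ range hc.time := by
          by_contra h0
          exact hx (hs.symm.trans (hc.jump_of_notMem h0))
        obtain ⟨i, rfl⟩ := hs'
        exact ⟨i, (hc.jump_time i).symm.trans hs, rfl⟩
      · rintro ⟨i, hi, rfl⟩
        exact (hc.jump_time i).trans hi
    rw [jumpCountOf, h, hc.time_injective.encard_image, Set.encard_eq_coe_toFinset_card]
    simp

theorem comp_perm (hc : IsSimpleConfig T c) (e : Equiv.Perm (Fin n)) : IsSimpleConfig T (c ∘ e) :=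
  ⟨hc.injective.comp e.injective, fun i => hc.mem (e i), fun i => hc.ne_zero (e i)⟩

end IsSimpleConfig

/-- Simple configurations listed in increasing order of the jump times. -/
def orderedConfigs (T : ℝ) (d n : ℕ) : Set (Fin n → ℝ × Rd d) :=
  {c | StrictMono (fun i => (c i).1) ∧ ∀ i, (c i).1 ∈ Ioc 0 T ∧ (c i).2 ≠ 0}

theorem isSimpleConfig_of_ordered {c : Fin n → ℝ × Rd d} (hc : c ∈ orderedConfigs T d n) :
    IsSimpleConfig T c :=
  ⟨hc.1.injective, fun i => (hc.2 i).1, fun i => (hc.2 i).2⟩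

theorem IsSimpleConfig.exists_ordered {c : Fin n → ℝ × Rd d} (hc : IsSimpleConfig T c) :
    ∃ c' ∈ orderedConfigs T d n, stepPath T c' = stepPath T c := by
  refine ⟨c ∘ Tuple.sort fun i => (c i).1, ⟨?_, fun i => ?_⟩, stepPath_comp_perm _ _⟩
  · have h := Tuple.monotone_sort fun i => (c i).1
    exact h.strictMono_of_injective ((hc.comp_perm _).injective)
  · exact ⟨hc.mem _, hc.ne_zero _⟩

theorem measurableSet_orderedConfigs : MeasurableSet (orderedConfigs T d n) := by
  have h : orderedConfigs T d n
      = (⋂ i, ⋂ j, ⋂ (_ : i < j), {c : Fin n → ℝ × Rd d | (c i).1 < (c j).1})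
        ∩ ⋂ i, ({c | (c i).1 ∈ Ioc 0 T} ∩ {c | (c i).2 ∈ ({0} : Set (Rd d))ᶜ}) := by
    ext c
    simp [orderedConfigs, StrictMono]
  rw [h]
  refine .inter (.iInter fun i => .iInter fun j => .iInter fun _ => ?_)
    (.iInter fun i => .inter ?_ ?_)
  · exact measurableSet_lt (by fun_prop) (by fun_prop)
  · exact (by fun_prop : Measurable fun c : Fin n → ℝ × Rd d => (c i).1) measurableSet_Ioc
  · exact (by fun_prop : Measurable fun c : Fin n → ℝ × Rd d => (c i).2)
      (measurableSet_singleton 0).compl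

/-- The path determines its set of jump times, a strictly increasing sequence is determined by its
range, and the jump sizes are then read off at those times. -/
theorem injOn_stepPath : InjOn (stepPath T) (orderedConfigs T d n) := by
  intro c hc c' hc' h
  have h1 := isSimpleConfig_of_ordered hc
  have h2 := isSimpleConfig_of_ordered hc'
  have hr : range h1.time = range h2.time := by rw [← h1.jumpTimes_eq, ← h2.jumpTimes_eq, h]
  have hm1 : StrictMono h1.time := fun i j hij => hc.1 hij
  have hm2 : StrictMono h2.time := fun i j hij => hc'.1 hij
  have ht : h1.time = h2.time := (hm1.range_inj hm2).1 hr
  funext i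
  have hi : h1.time i = h2.time i := congrFun ht i
  refine Prod.ext (congrArg Subtype.val hi) ?_
  rw [← h1.jump_time i, ← h2.jump_time i, hi, h]

end StepPath

/-! ### Measurability on path space through jump configurations -/

section Measurability

variable {T : ℝ} {d n : ℕ}

theorem measurable_eval_path (s : Icc (0 : ℝ) T) : Measurable fun w : PathSpace T d => w.1 s :=
  (measurable_pi_apply s).comp measurable_subtype_coe

theorem measurable_stepPath : Measurable (stepPath (d := d) (n := n) T) := by
  refine Measurable.subtype_mk (measurable_pi_lambda _ fun s => ?_)
  refine Finset.measurable_sum _ fun i _ => Measurable.ite ?_ (by fun_prop) measurable_const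
  exact measurableSet_le (by fun_prop) measurable_const

theorem measurable_shift :
    Measurable fun p : PathSpace T d × ℝ × Rd d => shift p.1 p.2.2 p.2.1 := by
  refine Measurable.subtype_mk (measurable_pi_lambda _ fun s => ?_)
  refine ((measurable_eval_path s).comp measurable_fst).add
    (Measurable.ite ?_ (by fun_prop) measurable_const)
  exact measurableSet_le (by fun_prop) measurable_const

theorem Measurable.shift {α : Type*} [MeasurableSpace α] {f : α → PathSpace T d} {g : α → Rd d}
    {h : α → ℝ} (hf : Measurable f) (hg : Measurable g) (hh : Measurable h) :
    Measurable fun a => _root_.shift (f a) (g a) (h a) :=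
  measurable_shift.comp (hf.prodMk (hh.prodMk hg))

/-- A càdlàg path is determined by its values on a dense set of times and at `T`. -/
theorem path_ext_of_dense {D : Set (Icc (0 : ℝ) T)} (hD : Dense D) {v w : PathSpace T d}
    (h : ∀ s ∈ D, v.1 s = w.1 s) (hT : ∀ s : Icc (0 : ℝ) T, (s : ℝ) = T → v.1 s = w.1 s) :
    v = w := by
  refine Subtype.ext (funext fun s => ?_)
  rcases eq_or_lt_of_le s.2.2 with hs | hs
  · exact hT s hs
  have hlt : s < (⟨T, s.2.1.trans s.2.2, le_rfl⟩ : Icc (0 : ℝ) T) := hs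
  -- For `s < T` there are points of `D` tending to `s` from the right, and right continuity
  -- applies. Nothing lies to the right of `T`, so the value there is a separate hypothesis.
  have hcl : s ∈ closure (Ioi s ∩ D) := by
    have h1 : closure (Ioi s) = Ici s := closure_Ioi' ⟨_, hlt⟩
    have h2 : closure (Ioi s) ⊆ closure (Ioi s ∩ D) :=
      closure_minimal (hD.open_subset_closure_inter isOpen_Ioi) isClosed_closure
    exact h2 (h1 ▸ self_mem_Ici)
  have hne : (𝓝[Ioi s ∩ D] s).NeBot := mem_closure_iff_nhdsWithin_neBot.1 hcl
  have hsub : Ioi s ∩ D ⊆ Ici s := fun r hr => mem_Ici.2 (le_of_lt hr.1)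
  have hv : Tendsto v.1 (𝓝[Ioi s ∩ D] s) (𝓝 (v.1 s)) := ((v.2 s).1.mono hsub)
  have hw : Tendsto w.1 (𝓝[Ioi s ∩ D] s) (𝓝 (w.1 s)) := ((w.2 s).1.mono hsub)
  refine tendsto_nhds_unique hv (hw.congr' ?_)
  filter_upwards [self_mem_nhdsWithin] with r hr using (h r hr.2).symm

/-- Injective measurable images of Borel sets are Borel (Lusin–Souslin) when the target is a
countable product of Polish spaces. Restricting paths to a countable dense set of times together
with `T` is injective and measurable, so the image is computed there and pulled back. -/
theorem measurableSet_stepPath_image {B : Set (Fin n → ℝ × Rd d)} (hB : MeasurableSet B) :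
    MeasurableSet (stepPath T '' (orderedConfigs T d n ∩ B)) := by
  obtain ⟨D₀, hD₀c, hD₀⟩ := TopologicalSpace.exists_countable_dense (Icc (0 : ℝ) T)
  set D : Set (Icc (0 : ℝ) T) := D₀ ∪ {s | (s : ℝ) = T} with hD
  have hDc : Countable D := by
    refine (hD₀c.union (Set.Subsingleton.countable ?_)).to_subtype
    exact fun a ha b hb => Subtype.ext (ha.trans hb.symm)
  set φ : PathSpace T d → D → Rd d := fun w s => w.1 s with hφ
  have hφi : Function.Injective φ := fun v w h =>
    path_ext_of_dense hD₀ (fun s hs => congrFun h ⟨s, Or.inl hs⟩)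
      fun s hs => congrFun h ⟨s, Or.inr hs⟩
  have hφm : Measurable φ := measurable_pi_lambda _ fun s => measurable_eval_path _
  have him : MeasurableSet ((φ ∘ stepPath T) '' (orderedConfigs T d n ∩ B)) :=
    (measurableSet_orderedConfigs.inter hB).image_of_measurable_injOn
      (hφm.comp measurable_stepPath)
      ((hφi.injOn.comp (injOn_stepPath.mono inter_subset_left) (mapsTo_univ _ _)))
  have := hφm him
  rwa [image_comp, preimage_image_eq _ hφi] at this

/-- The step paths with finitely many jumps, starting at `0`. -/
def stepSet (T : ℝ) (d : ℕ) : Set (PathSpace T d) :=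
  ⋃ n, stepPath T '' orderedConfigs T d n

theorem measurableSet_stepSet : MeasurableSet (stepSet T d) :=
  .iUnion fun n => by simpa using measurableSet_stepPath_image (T := T) (d := d) (n := n) .univ

theorem exists_of_mem_stepSet {w : PathSpace T d} (hw : w ∈ stepSet T d) :
    ∃ (n : ℕ) (c : Fin n → ℝ × Rd d), IsSimpleConfig T c ∧ stepPath T c = w := by
  obtain ⟨n, c, hc, rfl⟩ := mem_iUnion.1 hw
  exact ⟨n, c, isSimpleConfig_of_ordered hc, rfl⟩

theorem IsSimpleConfig.mem_stepSet {c : Fin n → ℝ × Rd d} (hc : IsSimpleConfig T c) :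
    stepPath T c ∈ stepSet T d := by
  obtain ⟨c', hc', h⟩ := hc.exists_ordered
  exact mem_iUnion.2 ⟨n, c', hc', h⟩

/-- A function of the path is a.e. measurable if it is a measurable function of the configuration
on simple configurations. -/
theorem aemeasurable_of_stepPath {β : Type*} [MeasurableSpace β] {μ : Measure (PathSpace T d)}
    (hμ : ∀ᵐ w ∂μ, w ∈ stepSet T d) {f : PathSpace T d → β}
    (g : ∀ n, (Fin n → ℝ × Rd d) → β) (hg : ∀ n, Measurable (g n))
    (hfg : ∀ n (c : Fin n → ℝ × Rd d), IsSimpleConfig T c → f (stepPath T c) = g n c) :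
    AEMeasurable f μ := by
  rw [← Measure.restrict_eq_self_of_ae_mem hμ]
  refine aemeasurable_restrict_of_measurable_subtype measurableSet_stepSet fun B hB => ?_
  -- On `stepSet`, the preimage of `B` under `f` is the union over `n` of the images of the ordered
  -- configurations that `g n` sends into `B`.
  refine ⟨⋃ n, stepPath T '' (orderedConfigs T d n ∩ g n ⁻¹' B),
    .iUnion fun n => measurableSet_stepPath_image (hg n hB), ?_⟩
  ext ⟨w, hw⟩
  simp only [mem_preimage, mem_iUnion]
  constructor
  · rintro ⟨n, c, hc, rfl⟩
    rw [hfg n c (isSimpleConfig_of_ordered hc.1)]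
    exact hc.2
  · intro h
    obtain ⟨n, c, hc, rfl⟩ := mem_iUnion.1 hw
    rw [hfg n c (isSimpleConfig_of_ordered hc)] at h
    exact ⟨n, c, ⟨hc, h⟩, rfl⟩

end Measurability

/-! ### Sums over the jumps of a path -/

section JumpSum

variable {T : ℝ} {d n : ℕ}

/-- The sum of `f` over the nonzero jumps of `w`, counted with multiplicity. -/
def jumpSum (f : Rd d → ℝ≥0∞) (w : PathSpace T d) : ℝ≥0∞ :=
  ∑' x, ENNReal.ofReal (jumpCountOf x w).toReal * f x

theorem IsSimpleConfig.jumpSum_eq (hT : 0 < T) {c : Fin n → ℝ × Rd d} (hc : IsSimpleConfig T c)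
    (f : Rd d → ℝ≥0∞) : jumpSum f (stepPath T c) = ∑ i, f (c i).2 := by
  classical
  have h : ∀ x, ENNReal.ofReal (jumpCountOf x (stepPath T c)).toReal * f x
      = ∑ i, if x = (c i).2 then f x else 0 := by
    intro x
    rw [hc.jumpCountOf_toReal hT, ENNReal.ofReal_sum_of_nonneg, Finset.sum_mul]
    · refine Finset.sum_congr rfl fun i _ => ?_
      by_cases hi : x = (c i).2
      · simp [hi]
      · simp [hi, Ne.symm hi]
    · intro i _
      split_ifs <;> simp
  simp_rw [jumpSum, h]
  rw [Summable.tsum_finsetSum fun i _ => ENNReal.summable]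
  refine Finset.sum_congr rfl fun i _ => ?_
  rw [tsum_eq_single (c i).2]
  · simp
  · intro x hx
    simp [hx]

theorem IsSimpleConfig.hasSum_jump (hT : 0 < T) {c : Fin n → ℝ × Rd d} (hc : IsSimpleConfig T c)
    (f : Rd d → ℝ) :
    HasSum (fun x => (jumpCountOf x (stepPath T c)).toReal * f x) (∑ i, f (c i).2) := by
  classical
  have h : (fun x => (jumpCountOf x (stepPath T c)).toReal * f x)
      = fun x => ∑ i, if x = (c i).2 then f (c i).2 else 0 := by
    funext x
    rw [hc.jumpCountOf_toReal hT, Finset.sum_mul]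
    refine Finset.sum_congr rfl fun i _ => ?_
    by_cases hi : x = (c i).2
    · simp [hi]
    · simp [hi, Ne.symm hi]
  rw [h]
  exact hasSum_sum fun i _ => hasSum_ite_eq _ _

end JumpSum

/-! ### The Poisson mixture of step paths and Mecke's formula -/

section StepMeasure

variable {d : ℕ}

/-- The law of the step path with a Poisson number of independent jumps with times distributed as
`U` and sizes distributed as `ν`. -/
def stepMeasure (T : ℝ) (r : ℝ≥0) (U : Measure ℝ) (ν : Measure (Rd d)) :
    Measure (PathSpace T d) :=
  Measure.sum fun n : ℕ =>
    poissonMeasure r {n} • (Measure.pi fun _ : Fin n => U.prod ν).map (stepPath T)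

variable {T : ℝ} {r : ℝ≥0} {U : Measure ℝ} {ν : Measure (Rd d)}

theorem lintegral_stepMeasure {f : PathSpace T d → ℝ≥0∞}
    (hf : AEMeasurable f (stepMeasure T r U ν)) :
    ∫⁻ w, f w ∂(stepMeasure T r U ν) = ∑' n : ℕ, poissonMeasure r {n} *
      ∫⁻ c, f (stepPath T c) ∂(Measure.pi fun _ : Fin n => U.prod ν) := by
  rw [stepMeasure, lintegral_sum_measure]
  refine tsum_congr fun n => ?_
  rw [lintegral_smul_measure, smul_eq_mul]
  -- A.e. measurability passes to the `n`-th component only if its weight is nonzero; otherwise both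
  -- terms are zero.
  by_cases hp : poissonMeasure r {n} = 0
  · simp [hp]
  · rw [lintegral_map' _ measurable_stepPath.aemeasurable]
    have h1 := hf.mono_measure (Measure.le_sum _ n)
    exact (aemeasurable_smul_measure_iff hp).1 h1

theorem tsum_poissonMeasure_singleton : ∑' n : ℕ, poissonMeasure r {n} = 1 := by
  have h := measure_univ (μ := poissonMeasure r)
  rw [← lintegral_one, lintegral_countable'] at h
  simpa using h

/-- This identity characterises the Poisson weights; it trades the factor counting the marked jumps
for the rate `r`. -/
theorem poissonMeasure_succ (n : ℕ) :
    poissonMeasure r {n + 1} * (n + 1 : ℕ) = r * poissonMeasure r {n} := by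
  rw [poissonMeasure_singleton, poissonMeasure_singleton, ← ENNReal.ofReal_natCast,
    ← ENNReal.ofReal_coe_nnreal, ← ENNReal.ofReal_mul (by positivity),
    ← ENNReal.ofReal_mul (by positivity), Nat.factorial_succ]
  congr 1
  push_cast
  have : (n.factorial : ℝ) ≠ 0 := by positivity
  field_simp
  ring

theorem measurable_sum_jump {f : Rd d × PathSpace T d → ℝ≥0∞} (hf : Measurable f) (n : ℕ) :
    Measurable fun c : Fin n → ℝ × Rd d => ∑ i, f ((c i).2, stepPath T c) :=
  Finset.measurable_sum _ fun i _ =>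
    hf.comp (Measurable.prodMk (by fun_prop) measurable_stepPath)

theorem aemeasurable_jumpSum (hT : 0 < T) {μ : Measure (PathSpace T d)}
    (hμ : ∀ᵐ w ∂μ, w ∈ stepSet T d) {f : Rd d × PathSpace T d → ℝ≥0∞} (hf : Measurable f) :
    AEMeasurable (fun w => jumpSum (fun x => f (x, w)) w) μ :=
  aemeasurable_of_stepPath hμ (fun _ c => ∑ i, f ((c i).2, stepPath T c))
    (measurable_sum_jump hf) fun _ _ hc => hc.jumpSum_eq hT _

variable [IsProbabilityMeasure U] [IsProbabilityMeasure ν]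

instance : IsProbabilityMeasure (stepMeasure T r U ν) := by
  constructor
  rw [← lintegral_one, lintegral_stepMeasure aemeasurable_const]
  simp [tsum_poissonMeasure_singleton]

/-- The pairs are independent and identically distributed, so splitting off the `i`-th one leaves an
independent configuration of `n` pairs, shifted by it. The right side does not depend on `i`. -/
theorem lintegral_pi_jump {f : Rd d × PathSpace T d → ℝ≥0∞} (hf : Measurable f) (n : ℕ)
    (i : Fin (n + 1)) :
    ∫⁻ c, f ((c i).2, stepPath T c) ∂(Measure.pi fun _ : Fin (n + 1) => U.prod ν)
      = ∫⁻ c, ∫⁻ p, f (p.2, shift (stepPath T c) p.2 p.1) ∂(U.prod ν)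
        ∂(Measure.pi fun _ : Fin n => U.prod ν) := by
  have hp := measurePreserving_piFinSuccAbove (fun _ : Fin (n + 1) => U.prod ν) i
  have hm : Measurable fun q : (ℝ × Rd d) × (Fin n → ℝ × Rd d) =>
      f (q.1.2, shift (stepPath T q.2) q.1.2 q.1.1) := by
    refine hf.comp (Measurable.prodMk (by fun_prop)
      (Measurable.shift ?_ (by fun_prop) (by fun_prop)))
    exact measurable_stepPath.comp measurable_snd
  rw [← lintegral_prod_symm' _ hm, ← hp.lintegral_comp hm]
  refine lintegral_congr fun c => ?_
  rw [stepPath_eq_shift c i]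
  rfl

variable [NullSingletonClass U]

theorem ae_isSimpleConfig (hU : ∀ᵐ t ∂U, t ∈ Ioc 0 T) (hν : ν {0} = 0) (n : ℕ) :
    ∀ᵐ c ∂(Measure.pi fun _ : Fin n => U.prod ν), IsSimpleConfig T c := by
  have h1 : ∀ i, ∀ᵐ c ∂(Measure.pi fun _ : Fin n => U.prod ν), (c i).1 ∈ Ioc 0 T := fun i =>
    (Measure.quasiMeasurePreserving_fst.comp
      (Measure.quasiMeasurePreserving_eval (fun _ : Fin n => U.prod ν) i)).ae hU
  have hν' : ∀ᵐ x ∂ν, x ≠ 0 := by simpa [ae_iff] using hν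
  have h2 : ∀ i, ∀ᵐ c ∂(Measure.pi fun _ : Fin n => U.prod ν), (c i).2 ≠ 0 := fun i =>
    (Measure.quasiMeasurePreserving_snd.comp
      (Measure.quasiMeasurePreserving_eval (fun _ : Fin n => U.prod ν) i)).ae hν'
  have h3 : ∀ i j, i ≠ j →
      ∀ᵐ c ∂(Measure.pi fun _ : Fin n => U.prod ν), (c i).1 ≠ (c j).1 := by
    intro i j hij
    obtain ⟨n, rfl⟩ : ∃ m, n = m + 1 := ⟨n - 1, by have := i.pos; omega⟩
    obtain ⟨k, rfl⟩ := Fin.exists_succAbove_eq hij.symm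
    have hp := measurePreserving_piFinSuccAbove (fun _ : Fin (n + 1) => U.prod ν) i
    -- With the `i`-th time fixed, the time of another pair avoids it almost surely because `U` has
    -- no atoms.
    have hae : ∀ᵐ p ∂(U.prod ν).prod (Measure.pi fun _ : Fin n => U.prod ν),
        p.1.1 ≠ (p.2 k).1 := by
      have hm : MeasurableSet {p : (ℝ × Rd d) × (Fin n → ℝ × Rd d) | p.1.1 ≠ (p.2 k).1} :=
        (measurableSet_eq_fun (by fun_prop) (by fun_prop)).compl
      refine Measure.measure_prod_null_of_ae_null hm.compl (Eventually.of_forall fun p => ?_)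
      have : ∀ᵐ t ∂U, p.1 ≠ t := by simp [ae_iff]
      exact (Measure.quasiMeasurePreserving_fst.comp
        (Measure.quasiMeasurePreserving_eval (fun _ : Fin n => U.prod ν) k)).ae this
    exact hp.quasiMeasurePreserving.ae hae
  filter_upwards [ae_all_iff.2 h1, ae_all_iff.2 h2,
    ae_all_iff.2 fun i => ae_all_iff.2 fun j => ae_all_iff.2 fun h => h3 i j h] with c hc1 hc2 hc3
  refine ⟨fun i j hij => ?_, hc1, hc2⟩
  by_contra h
  exact hc3 i j h hij

theorem ae_mem_stepSet (hU : ∀ᵐ t ∂U, t ∈ Ioc 0 T) (hν : ν {0} = 0) :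
    ∀ᵐ w ∂(stepMeasure T r U ν), w ∈ stepSet T d := by
  refine (Measure.ae_sum_iff' measurableSet_stepSet).2 ?_
  refine fun n => Measure.ae_smul_measure ?_ _
  rw [ae_map_iff measurable_stepPath.aemeasurable measurableSet_stepSet]
  filter_upwards [ae_isSimpleConfig hU hν n] with c hc using hc.mem_stepSet

/-- Mecke's formula for the jumps of the step path. -/
theorem lintegral_jumpSum (hT : 0 < T) (hU : ∀ᵐ t ∂U, t ∈ Ioc 0 T) (hν : ν {0} = 0)
    {f : Rd d × PathSpace T d → ℝ≥0∞} (hf : Measurable f) :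
    ∫⁻ w, jumpSum (fun x => f (x, w)) w ∂(stepMeasure T r U ν)
      = r * ∫⁻ w, ∫⁻ p, f (p.2, shift w p.2 p.1) ∂(U.prod ν) ∂(stepMeasure T r U ν) := by
  have hm : Measurable fun q : PathSpace T d × (ℝ × Rd d) => f (q.2.2, shift q.1 q.2.2 q.2.1) :=
    hf.comp (Measurable.prodMk (by fun_prop) measurable_shift)
  -- The term with no jumps contributes zero on the left, so the series is re-indexed from `n` to `n
  -- + 1`; each of the `n + 1` jumps then contributes the same integral.
  rw [lintegral_stepMeasure (aemeasurable_jumpSum hT (ae_mem_stepSet hU hν) hf),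
    lintegral_stepMeasure hm.lintegral_prod_right'.aemeasurable, ← ENNReal.tsum_mul_left,
    tsum_eq_zero_add' ENNReal.summable]
  have h0 : ∀ n, ∫⁻ c, jumpSum (fun x => f (x, stepPath T c)) (stepPath T c)
        ∂(Measure.pi fun _ : Fin n => U.prod ν)
      = ∑ i, ∫⁻ c, f ((c i).2, stepPath T c) ∂(Measure.pi fun _ : Fin n => U.prod ν) := by
    intro n
    rw [← lintegral_finsetSum]
    · refine lintegral_congr_ae ?_
      filter_upwards [ae_isSimpleConfig hU hν n] with c hc using hc.jumpSum_eq hT _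
    · exact fun i _ => hf.comp (Measurable.prodMk (by fun_prop) measurable_stepPath)
  simp_rw [h0, lintegral_pi_jump hf]
  simp only [Finset.univ_eq_empty, Finset.sum_empty, mul_zero, zero_add, Finset.sum_const,
    Finset.card_univ, Fintype.card_fin, nsmul_eq_mul]
  refine tsum_congr fun n => ?_
  rw [← mul_assoc, poissonMeasure_succ, mul_assoc]

end StepMeasure

/-! ### Characteristic functions of Poisson mixtures -/

section Mixture

theorem isProbabilityMeasure_poissonMixture {α : Type*} [MeasurableSpace α] (κ : ℕ → Measure α)
    [∀ n, IsProbabilityMeasure (κ n)] (r : ℝ≥0) :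
    IsProbabilityMeasure (Measure.sum fun n => poissonMeasure r {n} • κ n) := by
  constructor
  rw [Measure.sum_apply _ .univ]
  simp [tsum_poissonMeasure_singleton]

/-- This is the Poisson generating function, obtained by summing the exponential series. It serves
both for compound Poisson laws and for the increments of the step path. -/
theorem integral_poissonMixture {α : Type*} [MeasurableSpace α] {κ : ℕ → Measure α}
    [∀ n, IsProbabilityMeasure (κ n)] {r : ℝ≥0} {f : α → ℂ} (hf : Measurable f)
    (hb : ∀ a, ‖f a‖ ≤ 1) {z : ℂ} (hz : ∀ n, ∫ a, f a ∂(κ n) = z ^ n) :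
    ∫ a, f a ∂(Measure.sum fun n => poissonMeasure r {n} • κ n) = Complex.exp (r * (z - 1)) := by
  have := isProbabilityMeasure_poissonMixture κ r
  have hi : Integrable f (Measure.sum fun n => poissonMeasure r {n} • κ n) :=
    .of_bound hf.aestronglyMeasurable 1 (Eventually.of_forall hb)
  have h1 := hasSum_integral_measure hi
  have h2 : HasSum (fun n : ℕ => Complex.exp (-r) * ((r * z) ^ n / n.factorial))
      (Complex.exp (-r) * Complex.exp (r * z)) := by
    have := NormedSpace.expSeries_div_hasSum_exp (r * z : ℂ)
    rw [← Complex.exp_eq_exp_ℂ] at this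
    exact this.mul_left _
  have h3 : (fun n : ℕ => ∫ a, f a ∂(poissonMeasure r {n} • κ n))
      = fun n : ℕ => Complex.exp (-r) * ((r * z) ^ n / n.factorial) := by
    funext n
    rw [integral_smul_measure, hz, ← measureReal_def, poissonMeasure_real_singleton,
      Complex.real_smul, mul_pow]
    push_cast
    ring
  rw [h3] at h1
  rw [h1.unique h2, ← Complex.exp_add]
  congr 1
  ring

variable {d : ℕ} {ν : Measure (Rd d)} [IsProbabilityMeasure ν]

instance isProbabilityMeasure_map_sum (n : ℕ) : IsProbabilityMeasure
    ((Measure.pi fun _ : Fin n => ν).map (fun y => ∑ i, y i)) :=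
  Measure.isProbabilityMeasure_map (by fun_prop)

instance (r : ℝ≥0) : IsProbabilityMeasure (compoundPoisson r ν) :=
  isProbabilityMeasure_poissonMixture _ r

theorem charFunDual_compoundPoisson (r : ℝ≥0) (L : StrongDual ℝ (Rd d)) :
    charFunDual (compoundPoisson r ν) L = Complex.exp (r * (charFunDual ν L - 1)) := by
  rw [charFunDual_apply, compoundPoisson]
  refine integral_poissonMixture (by fun_prop) (fun a => ?_) fun n => ?_
  · rw [Complex.norm_exp_ofReal_mul_I]
  · rw [integral_map (by fun_prop) (by fun_prop), charFunDual_apply]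
    have := integral_fintype_prod_eq_pow (ι := Fin n) (μ := ν)
      (fun x => Complex.exp (L x * Complex.I))
    rw [Fintype.card_fin] at this
    rw [← this]
    refine integral_congr_ae (Eventually.of_forall fun y => ?_)
    simp only [map_sum, Complex.ofReal_sum, Finset.sum_mul, Complex.exp_sum]

end Mixture

/-! ### Identification of the law of the Poisson process -/

section Increments

variable {T : ℝ} {d k : ℕ}

/-- The increments of a path between consecutive times. -/
def increments (t : Fin (k + 1) → Icc (0 : ℝ) T) (w : PathSpace T d) : Fin k → Rd d :=
  fun j => w.1 (t j.succ) - w.1 (t j.castSucc)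

theorem measurable_increments (t : Fin (k + 1) → Icc (0 : ℝ) T) :
    Measurable (increments (d := d) t) :=
  measurable_pi_lambda _ fun _ => (measurable_eval_path _).sub (measurable_eval_path _)

/-- The increments of a single step. -/
def stepIncrements (t : Fin (k + 1) → Icc (0 : ℝ) T) (p : ℝ × Rd d) : Fin k → Rd d :=
  fun j => if p.1 ∈ Ioc (t j.castSucc : ℝ) (t j.succ) then p.2 else 0

theorem increments_stepPath {t : Fin (k + 1) → Icc (0 : ℝ) T} (ht : Monotone t) {n : ℕ}
    (c : Fin n → ℝ × Rd d) :
    increments t (stepPath T c) = ∑ i, stepIncrements t (c i) := by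
  funext j
  rw [increments, stepPath_apply, stepPath_apply, ← Finset.sum_sub_distrib, Finset.sum_apply]
  refine Finset.sum_congr rfl fun i _ => ?_
  have hj : (t j.castSucc : ℝ) ≤ t j.succ := ht j.castSucc_lt_succ.le
  rw [stepIncrements]
  by_cases h1 : (c i).1 ≤ (t j.castSucc : ℝ)
  · simp [h1, h1.trans hj, h1.not_gt]
  · by_cases h2 : (c i).1 ≤ (t j.succ : ℝ)
    · simp [h1, h2, not_le.1 h1]
    · simp [h1, h2]

/-- The intervals between consecutive times are disjoint, so a single step contributes to at most
one increment. The exponential thus becomes a sum over the intervals, and after the Poisson mixture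
this sum in the exponent turns into a product, which gives independence. -/
theorem exp_stepIncrements {t : Fin (k + 1) → Icc (0 : ℝ) T} (ht : Monotone t)
    (L : StrongDual ℝ (Fin k → Rd d)) (p : ℝ × Rd d) :
    Complex.exp (L (stepIncrements t p) * Complex.I)
      = 1 + ∑ j : Fin k, (Ioc (t j.castSucc : ℝ) (t j.succ)).indicator 1 p.1 *
        (Complex.exp (L.comp (.single ℝ (fun _ => Rd d) j) p.2 * Complex.I) - 1) := by
  by_cases h : ∃ j : Fin k, p.1 ∈ Ioc (t j.castSucc : ℝ) (t j.succ)
  · obtain ⟨j, hj⟩ := h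
    have hne : ∀ i, i ≠ j → p.1 ∉ Ioc (t i.castSucc : ℝ) (t i.succ) := by
      intro i hi hpi
      rcases lt_or_gt_of_ne hi with hlt | hlt
      · have : (t i.succ : ℝ) ≤ t j.castSucc := ht (Fin.succ_le_castSucc_iff.2 hlt)
        exact (hpi.2.trans this).not_gt hj.1
      · have : (t j.succ : ℝ) ≤ t i.castSucc := ht (Fin.succ_le_castSucc_iff.2 hlt)
        exact (hj.2.trans this).not_gt hpi.1
    have hs : stepIncrements t p = Pi.single j p.2 := by
      funext i
      rcases eq_or_ne i j with rfl | hi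
      · simp only [stepIncrements, if_pos hj, Pi.single_eq_same]
      · simp only [stepIncrements, if_neg (hne i hi), Pi.single_eq_of_ne hi]
    rw [Finset.sum_eq_single j (fun i _ hi => by simp [indicator_of_notMem (hne i hi)]) (by simp),
      indicator_of_mem hj, hs]
    simp
  · push Not at h
    have hs : stepIncrements t p = 0 := by
      funext i
      simp only [stepIncrements, if_neg (h i), Pi.zero_apply]
    rw [Finset.sum_eq_zero fun i _ => by simp [indicator_of_notMem (h i)], hs]
    simp

variable {ν : Measure (Rd d)} [IsProbabilityMeasure ν]

/-- The uniform distribution on `[0,T]`. -/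
abbrev unif (T : ℝ) : Measure ℝ := ProbabilityTheory.cond volume (Icc 0 T)

theorem isProbabilityMeasure_uniform (hT : 0 < T) :
    IsProbabilityMeasure (unif T) :=
  cond_isProbabilityMeasure_of_finite (by simp [hT]) (by simp)

theorem uniform_eq (T : ℝ) : unif T
    = (ENNReal.ofReal T)⁻¹ • (volume : Measure ℝ).restrict (Icc 0 T) := by
  rw [unif, ProbabilityTheory.cond, Real.volume_Icc, sub_zero]

theorem uniform_real_Ioc {s t : ℝ} (hT : 0 < T) (hs : 0 ≤ s) (hst : s ≤ t) (ht : t ≤ T) :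
    (unif T).real (Ioc s t) = (t - s) / T := by
  have h : Ioc s t ∩ Icc 0 T = Ioc s t :=
    inter_eq_left.2 fun x hx => ⟨hs.trans hx.1.le, hx.2.trans ht⟩
  rw [uniform_eq, measureReal_def, Measure.smul_apply, Measure.restrict_apply measurableSet_Ioc, h,
    Real.volume_Ioc, smul_eq_mul, ENNReal.toReal_mul, ENNReal.toReal_inv,
    ENNReal.toReal_ofReal hT.le, ENNReal.toReal_ofReal (sub_nonneg.2 hst)]
  ring

theorem integral_exp_stepIncrements (hT : 0 < T) {t : Fin (k + 1) → Icc (0 : ℝ) T}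
    (ht : Monotone t) (L : StrongDual ℝ (Fin k → Rd d)) :
    ∫ p, Complex.exp (L (stepIncrements t p) * Complex.I)
        ∂((unif T).prod ν)
      = 1 + ∑ j, (((t j.succ : ℝ) - t j.castSucc) / T : ℝ) *
        (charFunDual ν (L.comp (.single ℝ (fun _ => Rd d) j)) - 1) := by
  have := isProbabilityMeasure_uniform hT
  have hi : ∀ L : StrongDual ℝ (Rd d),
      Integrable (fun x => Complex.exp (L x * Complex.I) - 1) ν := fun L =>
    (Integrable.of_bound (by fun_prop) 1
      (Eventually.of_forall fun x => by rw [Complex.norm_exp_ofReal_mul_I])).sub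
      (integrable_const _)
  have hj : ∀ s : Set ℝ, MeasurableSet s → Integrable (s.indicator (1 : ℝ → ℂ))
      (unif T) := fun s hs =>
    (integrable_const (1 : ℂ)).indicator hs
  simp_rw [exp_stepIncrements ht]
  rw [integral_add (integrable_const _)
    (integrable_finsetSum _ fun j _ => (hj _ measurableSet_Ioc).mul_prod (hi _)),
    integral_finsetSum _ fun j _ => (hj _ measurableSet_Ioc).mul_prod (hi _)]
  congr 1
  · simp
  refine Finset.sum_congr rfl fun j _ => ?_
  rw [integral_prod_mul (fun s => (Ioc (t j.castSucc : ℝ) (t j.succ)).indicator (1 : ℝ → ℂ) s)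
    fun x => Complex.exp (L.comp (.single ℝ (fun _ => Rd d) j) x * Complex.I) - 1]
  congr 1
  · have h1 : ∀ x, (Ioc (t j.castSucc : ℝ) (t j.succ)).indicator (1 : ℝ → ℂ) x
        = (Ioc (t j.castSucc : ℝ) (t j.succ)).indicator (fun _ => 1) x := fun _ => rfl
    simp_rw [h1]
    rw [integral_indicator measurableSet_Ioc, setIntegral_const, Complex.real_smul, mul_one,
      uniform_real_Ioc hT (t _).2.1 (ht j.castSucc_lt_succ.le) (t _).2.2]
  · rw [integral_sub _ (integrable_const _), charFunDual_apply]
    · simp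
    · exact Integrable.of_bound (by fun_prop) 1
        (Eventually.of_forall fun x => by rw [Complex.norm_exp_ofReal_mul_I])

/-- The increments of the step path are independent with compound Poisson laws. -/
theorem map_increments_stepMeasure (hT : 0 < T) {t : Fin (k + 1) → Icc (0 : ℝ) T}
    (ht : Monotone t) :
    (stepMeasure T T.toNNReal (unif T) ν).map
        (increments t)
      = Measure.pi fun j : Fin k =>
        compoundPoisson (Real.toNNReal ((t j.succ : ℝ) - t j.castSucc)) ν := by
  have := isProbabilityMeasure_uniform hT
  have : IsProbabilityMeasure ((stepMeasure T T.toNNReal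
      (unif T) ν).map (increments t)) :=
    Measure.isProbabilityMeasure_map (measurable_increments t).aemeasurable
  refine charFunDual_eq_pi_iff.1 fun L => ?_
  simp_rw [charFunDual_compoundPoisson]
  rw [← Complex.exp_sum, charFunDual_apply,
    integral_map (measurable_increments t).aemeasurable (by fun_prop), stepMeasure]
  have hp : ∀ n, IsProbabilityMeasure ((Measure.pi fun _ : Fin n =>
      (unif T).prod ν).map (stepPath T)) := fun n =>
    Measure.isProbabilityMeasure_map measurable_stepPath.aemeasurable
  have hm : Measurable fun w : PathSpace T d => Complex.exp (L (increments t w) * Complex.I) := by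
    have := measurable_increments (d := d) t
    fun_prop
  rw [integral_poissonMixture hm (fun w => by rw [Complex.norm_exp_ofReal_mul_I])
    (z := ∫ p, Complex.exp (L (stepIncrements t p) * Complex.I)
        ∂((unif T).prod ν)) fun n => ?_]
  -- The mean number `T` of jumps times the probability `(t - s) / T` of falling in an interval is
  -- the rate `t - s` of that increment.
  · rw [integral_exp_stepIncrements hT ht, add_sub_cancel_left, Finset.mul_sum]
    congr 1
    refine Finset.sum_congr rfl fun j _ => ?_
    have hj : (0 : ℝ) ≤ (t j.succ : ℝ) - t j.castSucc :=
      sub_nonneg.2 (ht j.castSucc_lt_succ.le)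
    rw [← mul_assoc]
    congr 1
    rw [show ((T.toNNReal : ℝ≥0) : ℂ) = ((T.toNNReal : ℝ) : ℂ) from rfl,
      show ((Real.toNNReal ((t j.succ : ℝ) - t j.castSucc) : ℝ≥0) : ℂ)
        = ((Real.toNNReal ((t j.succ : ℝ) - t j.castSucc) : ℝ) : ℂ) from rfl,
      Real.coe_toNNReal _ hT.le, Real.coe_toNNReal _ hj, ← Complex.ofReal_mul,
      mul_div_cancel₀ _ hT.ne']
  · rw [integral_map measurable_stepPath.aemeasurable hm.aestronglyMeasurable]
    have := integral_fintype_prod_eq_pow (ι := Fin n)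
      (μ := (unif T).prod ν)
      (fun p => Complex.exp (L (stepIncrements t p) * Complex.I))
    rw [Fintype.card_fin] at this
    rw [← this]
    refine integral_congr_ae (Eventually.of_forall fun c => ?_)
    simp only [increments_stepPath ht, map_sum, Complex.ofReal_sum, Finset.sum_mul,
      Complex.exp_sum]

theorem sum_increments (a : Fin (k + 1) → Rd d) (m : Fin (k + 1)) :
    ∑ j : Fin k, (if j.succ ≤ m then a j.succ - a j.castSucc else 0) = a m - a 0 := by
  induction m using Fin.induction with
  | zero => simp
  | succ i ih =>
    have h : ∀ j : Fin k, (if j.succ ≤ i.succ then a j.succ - a j.castSucc else 0)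
        = (if j.succ ≤ i.castSucc then a j.succ - a j.castSucc else 0)
          + if j = i then a i.succ - a i.castSucc else 0 := by
      intro j
      rcases lt_trichotomy j i with h | rfl | h
      · rw [if_pos (Fin.succ_le_succ_iff.2 h.le), if_pos (Fin.succ_le_castSucc_iff.2 h),
          if_neg h.ne, add_zero]
      · rw [if_pos le_rfl, if_neg (not_le.2 j.castSucc_lt_succ), if_pos rfl, zero_add]
      · rw [if_neg (not_le.2 (Fin.succ_lt_succ_iff.2 h)),
          if_neg (not_le.2 (lt_trans i.castSucc_lt_succ (Fin.succ_lt_succ_iff.2 h))),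
          if_neg h.ne', add_zero]
    simp_rw [h, Finset.sum_add_distrib, ih]
    simp

/-- The law of a path starting at `0` is determined by the laws of its increments. -/
theorem ext_of_map_increments (hT : 0 ≤ T) {μ₁ μ₂ : Measure (PathSpace T d)}
    [IsProbabilityMeasure μ₁] [IsProbabilityMeasure μ₂]
    (h₁ : ∀ᵐ w ∂μ₁, w.1 ⟨0, left_mem_Icc.2 hT⟩ = 0) (h₂ : ∀ᵐ w ∂μ₂, w.1 ⟨0, left_mem_Icc.2 hT⟩ = 0)
    (h : ∀ (k : ℕ) (t : Fin (k + 1) → Icc (0 : ℝ) T), Monotone t →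
      μ₁.map (increments t) = μ₂.map (increments t)) : μ₁ = μ₂ := by
  have hv : Measurable (Subtype.val : PathSpace T d → Icc (0 : ℝ) T → Rd d) :=
    measurable_subtype_coe
  have : ∀ I : Finset (Icc (0 : ℝ) T),
      IsFiniteMeasure ((μ₁.map Subtype.val).map (I.restrict (π := fun _ => Rd d))) := fun I =>
    inferInstance
  have hmap : μ₁.map Subtype.val = μ₂.map Subtype.val := by
    refine IsProjectiveLimit.unique
      (P := fun I => (μ₁.map Subtype.val).map (I.restrict (π := fun _ => Rd d)))
      (fun I => rfl) fun I => ?_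
    classical
    set z : Icc (0 : ℝ) T := ⟨0, left_mem_Icc.2 hT⟩ with hz
    -- Time `0` is added because a value of the path is a sum of increments only once the starting
    -- value is known.
    set J := insert z I with hJ
    obtain ⟨k, hk⟩ : ∃ k, J.card = k + 1 :=
      ⟨J.card - 1, (Nat.succ_pred_eq_of_pos (Finset.card_pos.2 ⟨z, by simp [hJ]⟩)).symm⟩
    set t := J.orderEmbOfFin hk with ht
    have hr : ∀ s ∈ J, ∃ m, t m = s := by
      intro s hs
      have := J.range_orderEmbOfFin hk
      have hs' : s ∈ range (J.orderEmbOfFin hk) := by rw [this]; exact hs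
      exact hs'
    have ht0 : t 0 = z := by
      obtain ⟨m, hm⟩ := hr z (by simp [hJ])
      refine le_antisymm ?_ (t 0).2.1
      rw [← hm]
      exact t.monotone (Fin.zero_le m)
    choose m hm using fun s : I => hr s (Finset.mem_insert_of_mem s.2)
    -- Partial sums recover the values at the times of `I` from the increments, by telescoping from
    -- the value `0` at time `0`.
    set Φ : (Fin k → Rd d) → I → Rd d := fun y s =>
      ∑ j : Fin k, if j.succ ≤ m s then y j else 0 with hΦ
    have hΦm : Measurable Φ := by
      refine measurable_pi_lambda _ fun s => Finset.measurable_sum _ fun j _ => ?_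
      exact Measurable.ite (.const _) (measurable_pi_apply j) measurable_const
    have key : ∀ μ : Measure (PathSpace T d), (∀ᵐ w ∂μ, w.1 z = 0) →
        (μ.map Subtype.val).map (I.restrict (π := fun _ => Rd d))
          = (μ.map (increments t)).map Φ := by
      intro μ hμ
      rw [Measure.map_map (by fun_prop) hv, Measure.map_map hΦm (measurable_increments _)]
      refine Measure.map_congr ?_
      filter_upwards [hμ] with w hw
      funext s
      have := sum_increments (fun i => w.1 (t i)) (m s)
      simp only [Function.comp_apply, hΦ, increments]
      rw [this, hm, ht0, hw, sub_zero]
      rfl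
    change (μ₂.map Subtype.val).map _ = (μ₁.map Subtype.val).map _
    rw [key μ₁ h₁, key μ₂ h₂, h k t t.monotone]
  ext s hs
  obtain ⟨B, hB, rfl⟩ := hs
  rw [← Measure.map_apply hv hB, hmap, Measure.map_apply hv hB]

theorem ae_mem_Ioc_uniform (T : ℝ) :
    ∀ᵐ t ∂(unif T), t ∈ Ioc 0 T := by
  rw [uniform_eq, ← restrict_Ioc_eq_restrict_Icc]
  exact Measure.ae_smul_measure (ae_restrict_mem measurableSet_Ioc) _

instance nullSingletonClass_uniform :
    NullSingletonClass (unif T) := by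
  refine ⟨fun x => ?_⟩
  simp [uniform_eq]

/-- The law of a Poisson process is the law of the step path. -/
theorem IsPoissonProcess.map_eq_stepMeasure {Ω : Type*} [MeasurableSpace Ω] {P : Measure Ω}
    [IsProbabilityMeasure P] (hT : 0 < T) (hν : ν {0} = 0) {X : Ω → PathSpace T d}
    (hX : IsPoissonProcess X ν P) :
    P.map X = stepMeasure T T.toNNReal
      (unif T) ν := by
  have := isProbabilityMeasure_uniform hT
  have : IsProbabilityMeasure (P.map X) :=
    Measure.isProbabilityMeasure_map hX.measurable.aemeasurable
  refine ext_of_map_increments hT.le ?_ ?_ fun k t ht => ?_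
  · refine (ae_map_iff hX.measurable.aemeasurable
      ((measurable_eval_path _) (measurableSet_singleton (0 : Rd d)))).2 ?_
    exact hX.start _ rfl
  · filter_upwards [ae_mem_stepSet (ae_mem_Ioc_uniform T) hν] with w hw
    obtain ⟨n, c, hc, rfl⟩ := exists_of_mem_stepSet hw
    exact Finset.sum_eq_zero (s := Finset.univ) fun i _ => if_neg (not_le.2 (hc.mem i).1)
  · rw [map_increments_stepMeasure hT ht,
      Measure.map_map (measurable_increments t) hX.measurable]
    have hm : ∀ j : Fin k, AEMeasurable
        (fun a => (X a).1 (t j.succ) - (X a).1 (t j.castSucc)) P := fun j =>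
      (((measurable_eval_path _).comp hX.measurable).sub
        ((measurable_eval_path _).comp hX.measurable)).aemeasurable
    have := (iIndepFun_iff_map_fun_eq_pi_map hm).1 (hX.indep k t ht)
    simp_rw [hX.law _ _ (ht (Fin.castSucc_lt_succ).le)] at this
    exact this

end Increments

/-! ### The difference operator and the Dirichlet form -/

section ShiftDiff

variable {T : ℝ} {d : ℕ}

/-- The increment of `F` under the shift by a step. -/
def shiftDiff (F : PathSpace T d → ℝ) (p : PathSpace T d × ℝ × Rd d) : ℝ :=
  F (shift p.1 p.2.2 p.2.1) - F p.1

theorem shiftDiff_mul (F G : PathSpace T d → ℝ) (p : PathSpace T d × ℝ × Rd d) :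
    shiftDiff F p * shiftDiff G p = Gam p.2.1 p.2.2 F G p.1 := rfl

theorem Measurable.shiftDiff {F : PathSpace T d → ℝ} (hF : Measurable F) :
    Measurable (shiftDiff F) :=
  (hF.comp measurable_shift).sub (hF.comp measurable_fst)

/-- The reference measure `μ(dω) dt ν(dx)` on `M_T × [0,T] × ℝ^d`. -/
abbrev baseMeasure (ν : Measure (Rd d)) (μ : Measure (PathSpace T d)) :
    Measure (PathSpace T d × ℝ × Rd d) :=
  μ.prod (((volume : Measure ℝ).restrict (Icc 0 T)).prod ν)

/-- The random shift is nonsingular: it maps the reference measure to a measure absolutely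
continuous with respect to `μ`. -/
def IsNonsingularShift (ν : Measure (Rd d)) (μ : Measure (PathSpace T d)) : Prop :=
  Measure.QuasiMeasurePreserving
    (fun p : PathSpace T d × ℝ × Rd d => shift p.1 p.2.2 p.2.1) (baseMeasure ν μ) μ

variable {ν : Measure (Rd d)} {μ : Measure (PathSpace T d)}

theorem IsNonsingularShift.ae_shift (hq : IsNonsingularShift ν μ) {p : PathSpace T d → Prop}
    (h : ∀ᵐ w ∂μ, p w) : ∀ᵐ q ∂(baseMeasure ν μ), p (shift q.1 q.2.2 q.2.1) :=
  Measure.QuasiMeasurePreserving.ae hq h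

theorem ae_base_fst {p : PathSpace T d → Prop} (h : ∀ᵐ w ∂μ, p w) :
    ∀ᵐ q ∂(baseMeasure ν μ), p q.1 :=
  Measure.quasiMeasurePreserving_fst.ae h

theorem measurable_coe_Lp (F : Lp ℝ 2 μ) : Measurable F := (Lp.stronglyMeasurable F).measurable

theorem integrable_shiftDiff_mul {F G : PathSpace T d → ℝ}
    (hF : MemLp (shiftDiff F) 2 (baseMeasure ν μ)) (hG : MemLp (shiftDiff G) 2 (baseMeasure ν μ)) :
    Integrable (fun q => shiftDiff F q * shiftDiff G q) (baseMeasure ν μ) :=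
  hF.integrable_mul hG

/-- The exceptional null set has a null preimage under the random shift; this is why the form is
defined on classes. -/
theorem IsNonsingularShift.shiftDiff_congr (hq : IsNonsingularShift ν μ)
    {F F' : PathSpace T d → ℝ} (h : F =ᵐ[μ] F') :
    shiftDiff F =ᵐ[baseMeasure ν μ] shiftDiff F' := by
  filter_upwards [hq.ae_shift h, ae_base_fst h] with q h1 h2
  rw [shiftDiff, shiftDiff, h1, h2]

theorem IsNonsingularShift.shiftDiff_add (hq : IsNonsingularShift ν μ) (F G : Lp ℝ 2 μ) :
    shiftDiff ⇑(F + G) =ᵐ[baseMeasure ν μ] shiftDiff F + shiftDiff G := by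
  filter_upwards [hq.shiftDiff_congr (Lp.coeFn_add F G)] with q hq
  rw [hq]
  simp only [shiftDiff, Pi.add_apply]
  ring

theorem IsNonsingularShift.shiftDiff_sub (hq : IsNonsingularShift ν μ) (F G : Lp ℝ 2 μ) :
    shiftDiff ⇑(F - G) =ᵐ[baseMeasure ν μ] shiftDiff F - shiftDiff G := by
  filter_upwards [hq.shiftDiff_congr (Lp.coeFn_sub F G)] with q hq
  rw [hq]
  simp only [shiftDiff, Pi.sub_apply]
  ring

theorem IsNonsingularShift.shiftDiff_smul (hq : IsNonsingularShift ν μ) (c : ℝ) (F : Lp ℝ 2 μ) :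
    shiftDiff ⇑(c • F) =ᵐ[baseMeasure ν μ] c • shiftDiff F := by
  filter_upwards [hq.shiftDiff_congr (Lp.coeFn_smul c F)] with q hq
  rw [hq]
  simp only [shiftDiff, Pi.smul_apply, smul_eq_mul]
  ring

/-- If `F n → F` and the increments of `F n` converge to `g`, then `g` is the increment of `F`. -/
theorem IsNonsingularShift.shiftDiff_eq_of_tendsto (hq : IsNonsingularShift ν μ)
    {u : ℕ → Lp ℝ 2 μ} {F : Lp ℝ 2 μ} (hu : Tendsto u atTop (𝓝 F))
    {v : ℕ → Lp ℝ 2 (baseMeasure ν μ)} (huv : ∀ n, v n =ᵐ[baseMeasure ν μ] shiftDiff (u n))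
    {g : Lp ℝ 2 (baseMeasure ν μ)} (hv : Tendsto v atTop (𝓝 g)) :
    g =ᵐ[baseMeasure ν μ] shiftDiff F := by
  -- Successive extractions give one subsequence along which `u` and `v` both converge a.e.;
  -- nonsingularity carries the convergence of `u` over to the shifted paths.
  obtain ⟨ns, hns, h1⟩ := (tendstoInMeasure_of_tendsto_Lp hu).exists_seq_tendsto_ae
  have hv' : Tendsto (fun i => v (ns i)) atTop (𝓝 g) := hv.comp hns.tendsto_atTop
  obtain ⟨ms, hms, h2⟩ := (tendstoInMeasure_of_tendsto_Lp hv').exists_seq_tendsto_ae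
  filter_upwards [hq.ae_shift h1, ae_base_fst h1, h2, ae_all_iff.2 huv] with q h3 h4 h5 h6
  refine tendsto_nhds_unique h5 ?_
  have h7 := ((h3.sub h4).comp hms.tendsto_atTop)
  refine h7.congr fun i => ?_
  rw [h6]
  rfl

variable [IsProbabilityMeasure ν]

theorem energy_eq_lintegral {F : PathSpace T d → ℝ} (hF : Measurable F) :
    energy ν μ F = (ENNReal.ofReal T)⁻¹ *
      ∫⁻ q, ENNReal.ofReal (shiftDiff F q ^ 2) ∂(baseMeasure ν μ) := by
  have hm : Measurable fun q => ENNReal.ofReal (shiftDiff F q ^ 2) :=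
    (hF.shiftDiff.pow_const 2).ennreal_ofReal
  rw [energy, lintegral_prod _ hm.aemeasurable]
  congr 1
  refine lintegral_congr fun w => ?_
  have hw : Measurable fun y => ENNReal.ofReal (shiftDiff F (w, y) ^ 2) :=
    hm.comp measurable_prodMk_left
  rw [lintegral_prod _ hw.aemeasurable]
  simp_rw [sq, shiftDiff_mul]

theorem IsNonsingularShift.ae_Gam_eq (hq : IsNonsingularShift ν μ)
    {F F' G G' : PathSpace T d → ℝ} (hF : F =ᵐ[μ] F') (hG : G =ᵐ[μ] G') :
    ∀ᵐ w ∂μ, ∀ᵐ t ∂((volume : Measure ℝ).restrict (Icc 0 T)), ∀ᵐ x ∂ν,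
      Gam t x F G w = Gam t x F' G' w := by
  have h : ∀ᵐ q ∂(baseMeasure ν μ), Gam q.2.1 q.2.2 F G q.1 = Gam q.2.1 q.2.2 F' G' q.1 := by
    filter_upwards [hq.shiftDiff_congr hF, hq.shiftDiff_congr hG] with q h1 h2
    rw [← shiftDiff_mul, ← shiftDiff_mul, h1, h2]
  filter_upwards [Measure.ae_ae_of_ae_prod h] with w hw
  exact Measure.ae_ae_of_ae_prod hw

theorem IsNonsingularShift.energy_congr (hq : IsNonsingularShift ν μ)
    {F F' : PathSpace T d → ℝ} (h : F =ᵐ[μ] F') : energy ν μ F = energy ν μ F' := by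
  rw [energy, energy]
  congr 1
  refine lintegral_congr_ae ?_
  filter_upwards [hq.ae_Gam_eq h h] with w hw
  refine lintegral_congr_ae ?_
  filter_upwards [hw] with t ht
  refine lintegral_congr_ae ?_
  filter_upwards [ht] with x hx
  rw [hx]

theorem IsNonsingularShift.jumpForm_congr (hq : IsNonsingularShift ν μ)
    {F F' G G' : PathSpace T d → ℝ} (hF : F =ᵐ[μ] F') (hG : G =ᵐ[μ] G') :
    jumpForm ν μ F G = jumpForm ν μ F' G' := by
  rw [jumpForm, jumpForm]
  congr 1
  refine integral_congr_ae ?_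
  filter_upwards [hq.ae_Gam_eq hF hG] with w hw
  refine integral_congr_ae ?_
  filter_upwards [hw] with t ht
  refine integral_congr_ae ?_
  filter_upwards [ht] with x hx
  rw [hx]

/-- The form domain is the `L²` domain of the difference operator, so linearity and closedness
become statements about `L²` of the reference measure. -/
theorem memLp_shiftDiff_iff (hT : 0 < T) {F : PathSpace T d → ℝ} (hF : Measurable F) :
    energy ν μ F < ∞ ↔ MemLp (shiftDiff F) 2 (baseMeasure ν μ) := by
  have h0 : (ENNReal.ofReal T)⁻¹ ≠ 0 := by simp
  have h1 : (ENNReal.ofReal T)⁻¹ ≠ ∞ := by simp [hT]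
  rw [memLp_two_iff_integrable_sq hF.shiftDiff.aestronglyMeasurable, energy_eq_lintegral hF,
    Integrable, and_iff_right (hF.shiftDiff.pow_const 2).aestronglyMeasurable,
    hasFiniteIntegral_iff_ofReal (Eventually.of_forall fun q => sq_nonneg _)]
  constructor
  · intro h
    exact ENNReal.lt_top_of_mul_ne_top_right h.ne h0
  · exact fun h => ENNReal.mul_lt_top h1.lt_top h

theorem mem_jumpDomain_iff (hT : 0 < T) {F : Lp ℝ 2 μ} :
    F ∈ jumpDomain ν μ ↔ MemLp (shiftDiff F) 2 (baseMeasure ν μ) :=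
  memLp_shiftDiff_iff hT (measurable_coe_Lp F)

theorem IsNonsingularShift.mem_jumpDomain_of_ae_eq (hT : 0 < T) (hq : IsNonsingularShift ν μ)
    {F : Lp ℝ 2 μ} {F' : PathSpace T d → ℝ} (h : F =ᵐ[μ] F')
    (hF' : MemLp (shiftDiff F') 2 (baseMeasure ν μ)) : F ∈ jumpDomain ν μ :=
  (mem_jumpDomain_iff hT).2 (hF'.ae_eq (hq.shiftDiff_congr h.symm))

theorem IsNonsingularShift.add_mem (hT : 0 < T) (hq : IsNonsingularShift ν μ) {F G : Lp ℝ 2 μ}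
    (hF : F ∈ jumpDomain ν μ) (hG : G ∈ jumpDomain ν μ) : F + G ∈ jumpDomain ν μ := by
  rw [mem_jumpDomain_iff hT] at *
  exact (hF.add hG).ae_eq (hq.shiftDiff_add F G).symm

theorem IsNonsingularShift.sub_mem (hT : 0 < T) (hq : IsNonsingularShift ν μ) {F G : Lp ℝ 2 μ}
    (hF : F ∈ jumpDomain ν μ) (hG : G ∈ jumpDomain ν μ) : F - G ∈ jumpDomain ν μ := by
  rw [mem_jumpDomain_iff hT] at *
  exact (hF.sub hG).ae_eq (hq.shiftDiff_sub F G).symm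

theorem IsNonsingularShift.smul_mem (hT : 0 < T) (hq : IsNonsingularShift ν μ) (c : ℝ)
    {F : Lp ℝ 2 μ} (hF : F ∈ jumpDomain ν μ) : c • F ∈ jumpDomain ν μ := by
  rw [mem_jumpDomain_iff hT] at *
  exact (hF.const_smul c).ae_eq (hq.shiftDiff_smul c F).symm

variable [IsProbabilityMeasure μ]

theorem memLp_shiftDiff_of_bounded {F : PathSpace T d → ℝ} (hF : Measurable F) {C : ℝ}
    (hC : ∀ w, |F w| ≤ C) : MemLp (shiftDiff F) 2 (baseMeasure ν μ) := by
  refine MemLp.of_bound hF.shiftDiff.aestronglyMeasurable (C + C) (Eventually.of_forall fun q => ?_)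
  exact (abs_sub _ _).trans (add_le_add (hC _) (hC _))

theorem jumpForm_eq_integral {F G : PathSpace T d → ℝ}
    (hF : MemLp (shiftDiff F) 2 (baseMeasure ν μ)) (hG : MemLp (shiftDiff G) 2 (baseMeasure ν μ)) :
    jumpForm ν μ F G = T⁻¹ * ∫ q, shiftDiff F q * shiftDiff G q ∂(baseMeasure ν μ) := by
  have hi := integrable_shiftDiff_mul hF hG
  rw [jumpForm, integral_prod _ hi]
  congr 1
  refine integral_congr_ae ?_
  filter_upwards [hi.prod_right_ae] with w hw
  rw [integral_prod _ hw]
  rfl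

theorem jumpFormL2_eq_integral (hT : 0 < T) {F G : Lp ℝ 2 μ}
    (hF : F ∈ jumpDomain ν μ) (hG : G ∈ jumpDomain ν μ) :
    jumpFormL2 ν μ F G = T⁻¹ * ∫ q, shiftDiff F q * shiftDiff G q ∂(baseMeasure ν μ) :=
  jumpForm_eq_integral ((mem_jumpDomain_iff hT).1 hF) ((mem_jumpDomain_iff hT).1 hG)

theorem IsNonsingularShift.jumpFormL2_sub_self (hT : 0 < T) (hq : IsNonsingularShift ν μ)
    {F G : Lp ℝ 2 μ} (hF : F ∈ jumpDomain ν μ) (hG : G ∈ jumpDomain ν μ)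
    {f g : Lp ℝ 2 (baseMeasure ν μ)} (hf : f =ᵐ[baseMeasure ν μ] shiftDiff F)
    (hg : g =ᵐ[baseMeasure ν μ] shiftDiff G) :
    jumpFormL2 ν μ (F - G) (F - G) = T⁻¹ * ‖f - g‖ ^ 2 := by
  have hFG := hq.sub_mem hT hF hG
  rw [jumpFormL2_eq_integral hT hFG hFG, ← real_inner_self_eq_norm_sq, L2.inner_def]
  congr 1
  refine integral_congr_ae ?_
  filter_upwards [hf, hg, hq.shiftDiff_sub F G, Lp.coeFn_sub f g] with q h1 h2 h3 h4
  rw [h3, h4, Pi.sub_apply, Pi.sub_apply, h1, h2]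
  simp [sq]

/-- Simple functions are bounded, hence so are their differences, and the reference measure is
finite. -/
theorem dense_jumpDomain (hT : 0 < T) (hq : IsNonsingularShift ν μ) : Dense (jumpDomain ν μ) := by
  refine (Lp.simpleFunc.dense (E := ℝ) (p := 2) (μ := μ) (by simp)).mono fun F hF => ?_
  set f : Lp.simpleFunc ℝ 2 μ := ⟨F, hF⟩ with hf
  have h : (Lp.simpleFunc.toSimpleFunc f : PathSpace T d → ℝ) =ᵐ[μ] F :=
    Lp.simpleFunc.toSimpleFunc_eq_toFun f
  obtain ⟨C, hC⟩ := (Lp.simpleFunc.toSimpleFunc f).exists_forall_norm_le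
  exact hq.mem_jumpDomain_of_ae_eq hT h.symm
    (memLp_shiftDiff_of_bounded (SimpleFunc.measurable _) hC)

theorem abs_clip_sub_le (a b : ℝ) : |min (max a 0) 1 - min (max b 0) 1| ≤ |a - b| :=
  (abs_min_sub_min_le_max _ _ _ _).trans (by
    simp only [sub_self, abs_zero]
    refine max_le ((abs_max_sub_max_le_max _ _ _ _).trans ?_) (abs_nonneg _)
    simp)

theorem isSymmetricDirichletForm_jumpFormL2 (hT : 0 < T) (hq : IsNonsingularShift ν μ) :
    IsSymmetricDirichletForm μ (jumpDomain ν μ) (jumpFormL2 ν μ) where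
  zero_mem := hq.mem_jumpDomain_of_ae_eq hT (Lp.coeFn_zero ℝ 2 μ)
    (memLp_shiftDiff_of_bounded measurable_zero (C := 0) (by simp))
  add_mem F hF G hG := hq.add_mem hT hF hG
  smul_mem c F hF := hq.smul_mem hT c hF
  dense := dense_jumpDomain hT hq
  symm F hF G hG := by
    rw [jumpFormL2_eq_integral hT hF hG, jumpFormL2_eq_integral hT hG hF]
    simp_rw [mul_comm]
  add_left F hF G hG H hH := by
    rw [jumpFormL2_eq_integral hT (hq.add_mem hT hF hG) hH, jumpFormL2_eq_integral hT hF hH,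
      jumpFormL2_eq_integral hT hG hH, ← mul_add, ← integral_add
        (integrable_shiftDiff_mul ((mem_jumpDomain_iff hT).1 hF) ((mem_jumpDomain_iff hT).1 hH))
        (integrable_shiftDiff_mul ((mem_jumpDomain_iff hT).1 hG) ((mem_jumpDomain_iff hT).1 hH))]
    congr 1
    refine integral_congr_ae ?_
    filter_upwards [hq.shiftDiff_add F G] with q h
    rw [h, Pi.add_apply, add_mul]
  smul_left c F hF G hG := by
    rw [jumpFormL2_eq_integral hT (hq.smul_mem hT c hF) hG, jumpFormL2_eq_integral hT hF hG,
      mul_left_comm, ← integral_const_mul c]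
    congr 1
    refine integral_congr_ae ?_
    filter_upwards [hq.shiftDiff_smul c F] with q h
    rw [h, Pi.smul_apply, smul_eq_mul, mul_assoc]
  nonneg F hF := by
    rw [jumpFormL2_eq_integral hT hF hF]
    exact mul_nonneg (inv_nonneg.2 hT.le) (integral_nonneg fun q => mul_self_nonneg _)
  closed u hu hc := by
    -- A Cauchy sequence for the form norm is Cauchy in `L²` together with its differences; both
    -- limits exist, and the closed graph identifies the second as the difference of the first.
    have hu' := fun n => (mem_jumpDomain_iff hT).1 (hu n)
    set v : ℕ → Lp ℝ 2 (baseMeasure ν μ) := fun n => (hu' n).toLp _ with hv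
    have huv : ∀ n, v n =ᵐ[baseMeasure ν μ] shiftDiff (u n) := fun n => (hu' n).coeFn_toLp
    have hE : ∀ m n, jumpFormL2 ν μ (u m - u n) (u m - u n) = T⁻¹ * ‖v m - v n‖ ^ 2 := fun m n =>
      hq.jumpFormL2_sub_self hT (hu m) (hu n) (huv m) (huv n)
    have hcu : CauchySeq u := by
      refine Metric.cauchySeq_iff.2 fun ε hε => ?_
      obtain ⟨N, hN⟩ := hc (ε ^ 2) (by positivity)
      refine ⟨N, fun m hm n hn => ?_⟩
      have h := hN m hm n hn
      rw [hE] at h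
      rw [dist_eq_norm]
      refine lt_of_pow_lt_pow_left₀ 2 hε.le (lt_of_le_of_lt ?_ h)
      have : 0 ≤ T⁻¹ * ‖v m - v n‖ ^ 2 := by positivity
      linarith
    have hcv : CauchySeq v := by
      refine Metric.cauchySeq_iff.2 fun ε hε => ?_
      obtain ⟨N, hN⟩ := hc (T⁻¹ * ε ^ 2) (by positivity)
      refine ⟨N, fun m hm n hn => ?_⟩
      have h := hN m hm n hn
      rw [hE] at h
      rw [dist_eq_norm]
      refine lt_of_pow_lt_pow_left₀ 2 hε.le
        (lt_of_mul_lt_mul_left (lt_of_le_of_lt ?_ h) (inv_nonneg.2 hT.le))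
      have : 0 ≤ ‖u m - u n‖ ^ 2 := by positivity
      linarith
    obtain ⟨F, hF⟩ := cauchySeq_tendsto_of_complete hcu
    obtain ⟨g, hg⟩ := cauchySeq_tendsto_of_complete hcv
    have hgF := hq.shiftDiff_eq_of_tendsto hF huv hg
    have hFD : F ∈ jumpDomain ν μ := (mem_jumpDomain_iff hT).2 ((Lp.memLp g).ae_eq hgF)
    refine ⟨F, hFD, ?_⟩
    simp_rw [fun n => hq.jumpFormL2_sub_self hT (hu n) hFD (huv n) hgF]
    have h1 := ((tendsto_iff_norm_sub_tendsto_zero.1 hg).pow 2).const_mul T⁻¹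
    have h2 := (tendsto_iff_norm_sub_tendsto_zero.1 hF).pow 2
    simpa using h1.add h2
  markov F hF G hG := by
    have hF' := (mem_jumpDomain_iff hT).1 hF
    have hle : ∀ᵐ q ∂(baseMeasure ν μ), |shiftDiff G q| ≤ |shiftDiff F q| := by
      filter_upwards [hq.shiftDiff_congr hG] with q h
      rw [h]
      exact abs_clip_sub_le _ _
    have hGD : G ∈ jumpDomain ν μ := (mem_jumpDomain_iff hT).2
      (hF'.mono (measurable_coe_Lp G).shiftDiff.aestronglyMeasurable hle)
    have hG' := (mem_jumpDomain_iff hT).1 hGD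
    refine ⟨hGD, ?_⟩
    rw [jumpFormL2_eq_integral hT hF hF, jumpFormL2_eq_integral hT hGD hGD]
    refine mul_le_mul_of_nonneg_left (integral_mono_ae (integrable_shiftDiff_mul hG' hG')
      (integrable_shiftDiff_mul hF' hF') ?_) (inv_nonneg.2 hT.le)
    filter_upwards [hle] with q h
    exact abs_le_iff_mul_self_le.1 h

theorem isConservativeForm_jumpFormL2 (hT : 0 < T) (hq : IsNonsingularShift ν μ) :
    IsConservativeForm μ (jumpDomain ν μ) (jumpFormL2 ν μ) := by
  have hI : MemLp (fun _ : PathSpace T d => (1 : ℝ)) 2 μ := memLp_const 1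
  refine ⟨hI.toLp _, ?_, hI.coeFn_toLp, fun G hG => ?_⟩
  · exact hq.mem_jumpDomain_of_ae_eq hT hI.coeFn_toLp
      (memLp_shiftDiff_of_bounded measurable_const (C := 1) (by simp))
  · rw [jumpFormL2, hq.jumpForm_congr hI.coeFn_toLp (ae_eq_refl G), jumpForm]
    simp [Gam]

end ShiftDiff

/-! ### Mecke's formula for the Poisson law, density and moments -/

section PoissonLaw

variable {T : ℝ} {d : ℕ} {ν : Measure (Rd d)}

/-- The law on path space of the Poisson process of intensity `ν`. -/
abbrev poissonLaw (T : ℝ) (ν : Measure (Rd d)) : Measure (PathSpace T d) :=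
  stepMeasure T T.toNNReal (unif T) ν

theorem volume_restrict_eq (hT : 0 < T) :
    (volume : Measure ℝ).restrict (Icc 0 T) = ENNReal.ofReal T • unif T := by
  rw [uniform_eq, smul_smul, ENNReal.mul_inv_cancel (by simp [hT]) (by simp), one_smul]

/-- The canonical law of the process, the shift time and the shift size. -/
abbrev canonicalLaw (T : ℝ) (ν : Measure (Rd d)) : Measure (PathSpace T d × ℝ × Rd d) :=
  (poissonLaw T ν).prod ((unif T).prod ν)

variable [IsProbabilityMeasure ν]

theorem isProbabilityMeasure_poissonLaw (hT : 0 < T) : IsProbabilityMeasure (poissonLaw T ν) := by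
  have := isProbabilityMeasure_uniform hT
  infer_instance

theorem baseMeasure_eq (hT : 0 < T) (μ : Measure (PathSpace T d)) [IsProbabilityMeasure μ] :
    baseMeasure ν μ = ENNReal.ofReal T • μ.prod ((unif T).prod ν) := by
  have := isProbabilityMeasure_uniform hT
  rw [baseMeasure, volume_restrict_eq hT, Measure.prod_smul_left, Measure.prod_smul_right]

theorem ae_mem_stepSet_poissonLaw (hT : 0 < T) (hν : ν {0} = 0) :
    ∀ᵐ w ∂(poissonLaw T ν), w ∈ stepSet T d := by
  have := isProbabilityMeasure_uniform hT
  exact ae_mem_stepSet (ae_mem_Ioc_uniform T) hν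

/-- Mecke's formula for the Poisson process. -/
theorem lintegral_jumpSum_poissonLaw (hT : 0 < T) (hν : ν {0} = 0)
    {f : Rd d × PathSpace T d → ℝ≥0∞} (hf : Measurable f) :
    ∫⁻ w, jumpSum (fun x => f (x, w)) w ∂(poissonLaw T ν)
      = ∫⁻ q, f (q.2.2, shift q.1 q.2.2 q.2.1) ∂(baseMeasure ν (poissonLaw T ν)) := by
  have := isProbabilityMeasure_uniform hT
  have hm : Measurable fun q : PathSpace T d × ℝ × Rd d => f (q.2.2, shift q.1 q.2.2 q.2.1) :=
    hf.comp (Measurable.prodMk (by fun_prop) measurable_shift)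
  rw [lintegral_jumpSum hT (ae_mem_Ioc_uniform T) hν hf, baseMeasure_eq hT, lintegral_smul_measure,
    lintegral_prod _ hm.aemeasurable]
  rfl

theorem jumpSum_const {w : PathSpace T d} (hT : 0 < T) (hw : w ∈ stepSet T d) (a : ℝ≥0∞) :
    jumpSum (fun _ => a) w = jumpCount w * a := by
  obtain ⟨n, c, hc, rfl⟩ := exists_of_mem_stepSet hw
  rw [hc.jumpSum_eq hT, hc.jumpCount_eq]
  simp

theorem aemeasurable_jumpCount (hT : 0 < T) (hν : ν {0} = 0) :
    AEMeasurable (jumpCount (T := T) (d := d)) (poissonLaw T ν) :=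
  aemeasurable_of_stepPath (ae_mem_stepSet_poissonLaw hT hν) (fun n _ => (n : ℝ≥0∞))
    (fun _ => measurable_const) fun _ _ hc => hc.jumpCount_eq

/-- In Mecke's formula with `f` independent of the jump, every jump contributes the same value,
hence the factor `N_T`. -/
theorem lintegral_shift (hT : 0 < T) (hν : ν {0} = 0) {f : PathSpace T d → ℝ≥0∞}
    (hf : Measurable f) :
    ∫⁻ q, f (shift q.1 q.2.2 q.2.1) ∂(baseMeasure ν (poissonLaw T ν))
      = ∫⁻ w, jumpCount w * f w ∂(poissonLaw T ν) := by
  rw [← lintegral_jumpSum_poissonLaw hT hν (f := fun p => f p.2) (hf.comp measurable_snd)]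
  refine lintegral_congr_ae ?_
  filter_upwards [ae_mem_stepSet_poissonLaw hT hν] with w hw using jumpSum_const hT hw _

theorem isNonsingularShift_poissonLaw (hT : 0 < T) (hν : ν {0} = 0) :
    IsNonsingularShift ν (poissonLaw T ν) := by
  refine ⟨measurable_shift, .mk fun N hN h0 => ?_⟩
  rw [← lintegral_indicator_one hN, lintegral_map (measurable_one.indicator hN) measurable_shift,
    lintegral_shift hT hν (measurable_one.indicator hN), lintegral_eq_zero_of_ae_eq_zero]
  filter_upwards [measure_eq_zero_iff_ae_notMem.1 h0] with w hw
  simp [hw]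

/-- The law of the shifted process has density `N_T / T`. -/
theorem map_shift_eq_withDensity (hT : 0 < T) (hν : ν {0} = 0) :
    (canonicalLaw T ν).map (fun q => shift q.1 q.2.2 q.2.1)
      = (poissonLaw T ν).withDensity fun w => jumpCount w / ENNReal.ofReal T := by
  have := isProbabilityMeasure_poissonLaw (ν := ν) hT
  have hT0 : ENNReal.ofReal T ≠ 0 := by simp [hT]
  refine Measure.ext fun B hB => ?_
  have h := lintegral_shift hT hν (f := B.indicator 1) (measurable_one.indicator hB)
  rw [baseMeasure_eq hT, lintegral_smul_measure, smul_eq_mul,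
    ← lintegral_map (measurable_one.indicator hB) measurable_shift,
    lintegral_indicator_one hB] at h
  rw [withDensity_apply _ hB, ← lintegral_indicator hB]
  simp_rw [ENNReal.div_eq_inv_mul]
  have h2 : ∀ w : PathSpace T d, B.indicator (fun w => (ENNReal.ofReal T)⁻¹ * jumpCount w) w
      = (ENNReal.ofReal T)⁻¹ * (jumpCount w * B.indicator 1 w) := by
    intro w
    by_cases hw : w ∈ B <;> simp [hw]
  simp_rw [h2]
  have hm : AEMeasurable (fun w => jumpCount w * B.indicator 1 w) (poissonLaw T ν) :=
    (aemeasurable_jumpCount hT hν).mul (measurable_one.indicator hB).aemeasurable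
  rw [lintegral_const_mul'' _ hm, ← h, ← mul_assoc,
    ENNReal.inv_mul_cancel hT0 ENNReal.ofReal_ne_top, one_mul]

/-- The real-valued sum of `f` over the nonzero jumps. -/
def jumpSumReal (f : Rd d → ℝ) (w : PathSpace T d) : ℝ :=
  ∑' x, (jumpCountOf x w).toReal * f x

theorem IsSimpleConfig.jumpSumReal_eq {n : ℕ} (hT : 0 < T) {c : Fin n → ℝ × Rd d}
    (hc : IsSimpleConfig T c) (f : Rd d → ℝ) :
    jumpSumReal f (stepPath T c) = ∑ i, f (c i).2 := (hc.hasSum_jump hT f).tsum_eq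

theorem summable_jump (hT : 0 < T) {w : PathSpace T d} (hw : w ∈ stepSet T d) (f : Rd d → ℝ) :
    Summable fun x => (jumpCountOf x w).toReal * f x := by
  obtain ⟨n, c, hc, rfl⟩ := exists_of_mem_stepSet hw
  exact (hc.hasSum_jump hT f).summable

theorem aemeasurable_jumpSumReal (hT : 0 < T) (hν : ν {0} = 0) {φ : Rd d × PathSpace T d → ℝ}
    (hφ : Measurable φ) :
    AEMeasurable (fun w => jumpSumReal (fun x => φ (x, w)) w) (poissonLaw T ν) :=
  aemeasurable_of_stepPath (ae_mem_stepSet_poissonLaw hT hν)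
    (fun _ c => ∑ i, φ ((c i).2, stepPath T c))
    (fun _ => Finset.measurable_sum _ fun i _ =>
      hφ.comp (Measurable.prodMk (by fun_prop) measurable_stepPath))
    fun _ _ hc => hc.jumpSumReal_eq hT _

theorem abs_jumpSumReal_le (hT : 0 < T) {w : PathSpace T d} (hw : w ∈ stepSet T d)
    {f : Rd d → ℝ} {C : ℝ} (hf : ∀ x, |f x| ≤ C) :
    |jumpSumReal f w| ≤ C * (jumpCount w).toReal := by
  obtain ⟨n, c, hc, rfl⟩ := exists_of_mem_stepSet hw
  rw [hc.jumpSumReal_eq hT, hc.jumpCount_eq]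
  refine (Finset.abs_sum_le_sum_abs _ _).trans ((Finset.sum_le_sum fun i _ => hf _).trans ?_)
  simp [mul_comm]

theorem ofReal_jumpSumReal (hT : 0 < T) {w : PathSpace T d} (hw : w ∈ stepSet T d)
    {f : Rd d → ℝ} (hf : ∀ x, 0 ≤ f x) :
    ENNReal.ofReal (jumpSumReal f w) = jumpSum (fun x => ENNReal.ofReal (f x)) w := by
  obtain ⟨n, c, hc, rfl⟩ := exists_of_mem_stepSet hw
  rw [hc.jumpSumReal_eq hT, hc.jumpSum_eq hT, ENNReal.ofReal_sum_of_nonneg fun i _ => hf _]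

theorem jumpSumReal_nonneg {w : PathSpace T d} {f : Rd d → ℝ} (hf : ∀ x, 0 ≤ f x) :
    0 ≤ jumpSumReal f w :=
  tsum_nonneg fun x => mul_nonneg ENNReal.toReal_nonneg (hf x)

theorem jumpSumReal_mul_const (w : PathSpace T d) (f : Rd d → ℝ) (a : ℝ) :
    jumpSumReal (fun x => f x * a) w = jumpSumReal f w * a := by
  simp_rw [jumpSumReal, ← mul_assoc, tsum_mul_right]

theorem hasMecke_of_nonneg (hT : 0 < T) (hν : ν {0} = 0) {φ : Rd d × PathSpace T d → ℝ}
    (hφ : Measurable φ) (h0 : ∀ p, 0 ≤ φ p)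
    (hi : Integrable (fun q : PathSpace T d × ℝ × Rd d => φ (q.2.2, shift q.1 q.2.2 q.2.1))
      (baseMeasure ν (poissonLaw T ν))) :
    Integrable (fun w => jumpSumReal (fun x => φ (x, w)) w) (poissonLaw T ν) ∧
      ∫ w, jumpSumReal (fun x => φ (x, w)) w ∂(poissonLaw T ν)
        = ∫ q, φ (q.2.2, shift q.1 q.2.2 q.2.1) ∂(baseMeasure ν (poissonLaw T ν)) := by
  have hm := (aemeasurable_jumpSumReal hT hν hφ).aestronglyMeasurable
  have hnn : ∀ w : PathSpace T d, 0 ≤ jumpSumReal (fun x => φ (x, w)) w := fun w =>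
    jumpSumReal_nonneg fun x => h0 _
  have hl : ∫⁻ w, ENNReal.ofReal (jumpSumReal (fun x => φ (x, w)) w) ∂(poissonLaw T ν)
      = ∫⁻ q, ENNReal.ofReal (φ (q.2.2, shift q.1 q.2.2 q.2.1))
        ∂(baseMeasure ν (poissonLaw T ν)) := by
    rw [← lintegral_jumpSum_poissonLaw hT hν hφ.ennreal_ofReal]
    refine lintegral_congr_ae ?_
    filter_upwards [ae_mem_stepSet_poissonLaw hT hν] with w hw
    exact ofReal_jumpSumReal hT hw fun x => h0 _
  constructor
  · refine ⟨hm, (hasFiniteIntegral_iff_ofReal (Eventually.of_forall hnn)).2 ?_⟩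
    rw [hl]
    exact (hasFiniteIntegral_iff_ofReal (Eventually.of_forall fun q => h0 _)).1 hi.2
  · rw [integral_eq_lintegral_of_nonneg_ae (Eventually.of_forall hnn) hm, hl,
      integral_eq_lintegral_of_nonneg_ae (Eventually.of_forall fun q => h0 _) hi.1]

/-- Mecke's formula for integrable functions. -/
theorem integral_jumpSumReal (hT : 0 < T) (hν : ν {0} = 0) {φ : Rd d × PathSpace T d → ℝ}
    (hφ : Measurable φ)
    (hi : Integrable (fun q : PathSpace T d × ℝ × Rd d => φ (q.2.2, shift q.1 q.2.2 q.2.1))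
      (baseMeasure ν (poissonLaw T ν))) :
    Integrable (fun w => jumpSumReal (fun x => φ (x, w)) w) (poissonLaw T ν) ∧
      ∫ w, jumpSumReal (fun x => φ (x, w)) w ∂(poissonLaw T ν)
        = ∫ q, φ (q.2.2, shift q.1 q.2.2 q.2.1) ∂(baseMeasure ν (poissonLaw T ν)) := by
  obtain ⟨hp, hp'⟩ := hasMecke_of_nonneg hT hν (φ := fun p => max (φ p) 0)
    (hφ.max measurable_const) (fun p => le_max_right _ _) hi.pos_part
  obtain ⟨hn, hn'⟩ := hasMecke_of_nonneg hT hν (φ := fun p => max (-φ p) 0)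
    (hφ.neg.max measurable_const) (fun p => le_max_right _ _) hi.neg_part
  -- Almost every path has finitely many jumps, so positive and negative parts may be subtracted
  -- term by term.
  have hsub : ∀ᵐ w ∂(poissonLaw T ν), jumpSumReal (fun x => max (φ (x, w)) 0) w
      - jumpSumReal (fun x => max (-φ (x, w)) 0) w = jumpSumReal (fun x => φ (x, w)) w := by
    filter_upwards [ae_mem_stepSet_poissonLaw hT hν] with w hw
    obtain ⟨n, c, hc, rfl⟩ := exists_of_mem_stepSet hw
    simp_rw [hc.jumpSumReal_eq hT, ← Finset.sum_sub_distrib, max_zero_sub_max_neg_zero_eq_self]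
  refine ⟨(hp.sub hn).congr hsub, ?_⟩
  rw [← integral_congr_ae hsub, integral_sub hp hn, hp', hn',
    ← integral_sub hi.pos_part hi.neg_part]
  simp_rw [max_zero_sub_max_neg_zero_eq_self]

theorem summable_poisson_sq (r : ℝ) :
    Summable fun n : ℕ => Real.exp (-r) * r ^ n / n.factorial * (n : ℝ) ^ 2 := by
  have h := (Real.summable_pow_div_factorial (4 * |r|)).mul_left (Real.exp (-r))
  refine .of_norm_bounded h fun n => ?_
  have hn : (n : ℝ) ^ 2 ≤ 4 ^ n := by
    have h2 : (n : ℝ) ≤ 2 ^ n := by exact_mod_cast (Nat.lt_two_pow_self).le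
    calc (n : ℝ) ^ 2 ≤ (2 ^ n) ^ 2 := by gcongr
      _ = 4 ^ n := by rw [← pow_mul, mul_comm, pow_mul]; norm_num
  rw [Real.norm_eq_abs, abs_mul, abs_div, abs_mul, abs_pow, Real.abs_exp, Nat.abs_cast,
    abs_of_nonneg (sq_nonneg (n : ℝ)), mul_pow]
  calc Real.exp (-r) * |r| ^ n / n.factorial * (n : ℝ) ^ 2
      ≤ Real.exp (-r) * |r| ^ n / n.factorial * 4 ^ n := by gcongr
    _ = Real.exp (-r) * (4 ^ n * |r| ^ n / n.factorial) := by ring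

/-- `N_T` is Poisson of mean `T` under `μ`. Its second moment controls the removal part of the
generator and the integrability of shifted `L²` functions. -/
theorem memLp_jumpCount (hT : 0 < T) (hν : ν {0} = 0) :
    MemLp (fun w => (jumpCount w).toReal) 2 (poissonLaw T ν) := by
  have := isProbabilityMeasure_uniform hT
  have hm := (aemeasurable_jumpCount hT hν).ennreal_toReal
  refine (memLp_two_iff_integrable_sq hm.aestronglyMeasurable).2
    ⟨(hm.pow_const 2).aestronglyMeasurable, ?_⟩
  rw [hasFiniteIntegral_iff_ofReal (Eventually.of_forall fun w => sq_nonneg _),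
    lintegral_stepMeasure (hm.pow_const 2).ennreal_ofReal]
  have h : ∀ n : ℕ, ∫⁻ c, ENNReal.ofReal ((jumpCount (stepPath T c)).toReal ^ 2)
      ∂(Measure.pi fun _ : Fin n => (unif T).prod ν) = ENNReal.ofReal ((n : ℝ) ^ 2) := by
    intro n
    have h1 : ∀ᵐ c ∂(Measure.pi fun _ : Fin n => (unif T).prod ν),
        ENNReal.ofReal ((jumpCount (stepPath T c)).toReal ^ 2) = ENNReal.ofReal ((n : ℝ) ^ 2) := by
      filter_upwards [ae_isSimpleConfig (ae_mem_Ioc_uniform T) hν n] with c hc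
      rw [hc.jumpCount_eq]
      simp
    rw [lintegral_congr_ae h1]
    simp
  simp_rw [h, poissonMeasure_singleton]
  have h2 : ∀ n : ℕ, ENNReal.ofReal (Real.exp (-(T.toNNReal : ℝ)) * (T.toNNReal : ℝ) ^ n
      / n.factorial) * ENNReal.ofReal ((n : ℝ) ^ 2)
      = ENNReal.ofReal (Real.exp (-(T.toNNReal : ℝ)) * (T.toNNReal : ℝ) ^ n
        / n.factorial * (n : ℝ) ^ 2) := fun n => (ENNReal.ofReal_mul (by positivity)).symm
  simp_rw [h2]
  exact (summable_poisson_sq _).tsum_ofReal_lt_top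

/-- The integral of `|G|` at the shifted path is that of `N_T |G|`, finite because both factors are
in `L²(μ)`. -/
theorem integrable_shift (hT : 0 < T) (hν : ν {0} = 0) {G : PathSpace T d → ℝ}
    (hG : Measurable G) (hG2 : MemLp G 2 (poissonLaw T ν)) :
    Integrable (fun q : PathSpace T d × ℝ × Rd d => G (shift q.1 q.2.2 q.2.1))
      (baseMeasure ν (poissonLaw T ν)) := by
  refine ⟨(hG.comp measurable_shift).aestronglyMeasurable, ?_⟩
  have h := ((memLp_jumpCount hT hν).integrable_mul hG2).2
  rw [hasFiniteIntegral_iff_enorm] at h ⊢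
  rw [lintegral_shift hT hν (f := fun w => ‖G w‖ₑ) hG.enorm]
  refine lt_of_le_of_lt (lintegral_mono_ae ?_) h
  filter_upwards [ae_mem_stepSet_poissonLaw hT hν] with w hw
  obtain ⟨n, c, hc, rfl⟩ := exists_of_mem_stepSet hw
  rw [Pi.mul_apply, enorm_mul, hc.jumpCount_eq]
  simp

end PoissonLaw

/-! ### Uniqueness of the generator's value -/

section AbstractGenerator

variable {S : Type*} [MeasurableSpace S] {μ : Measure S} {D : Set (Lp ℝ 2 μ)}
  {E : Lp ℝ 2 μ → Lp ℝ 2 μ → ℝ}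

/-- An element of `L²` is determined by its inner products with a dense set, so the chosen
representative must be `H`. -/
theorem generator_eq_of_forall (hD : Dense D) {F H : Lp ℝ 2 μ} (hF : F ∈ D)
    (h : ∀ G ∈ D, E F G = -inner ℝ H G) :
    F ∈ generatorDomain μ D E ∧ generator μ D E F = H := by
  have hmem : F ∈ generatorDomain μ D E := ⟨hF, H, h⟩
  refine ⟨hmem, ?_⟩
  rw [generator, dif_pos hmem]
  have hs := hmem.2.choose_spec
  refine ext_inner_right ℝ fun v => ?_
  have hc : (fun v : Lp ℝ 2 μ => inner ℝ hmem.2.choose v) = fun v => inner ℝ H v :=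
    Continuous.ext_on hD (by fun_prop) (by fun_prop) fun G hG =>
      neg_injective ((hs G hG).symm.trans (h G hG))
  exact congrFun hc v

end AbstractGenerator

/-! ### The generator on bounded functions -/

section Generator

variable {T : ℝ} {d : ℕ} {ν : Measure (Rd d)} [IsProbabilityMeasure ν]

/-- The mean change of `F` when the jump `x` is removed at a time of law `π (x, w)`. -/
def removalMean (F : PathSpace T d → ℝ) (π : Kernel (Rd d × PathSpace T d) ℝ) (x : Rd d)
    (w : PathSpace T d) : ℝ :=
  ∫ t, (F (shift w (-x) t) - F w) ∂(π (x, w))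

/-- The mean change of `F` when a jump is added. -/
def additionMean (ν : Measure (Rd d)) (F : PathSpace T d → ℝ) (w : PathSpace T d) : ℝ :=
  ∫ t in Icc (0 : ℝ) T, ∫ x, (F (shift w x t) - F w) ∂ν

variable {F : PathSpace T d → ℝ} {C : ℝ}

theorem measurable_removal (hF : Measurable F) :
    Measurable fun p : (Rd d × PathSpace T d) × ℝ => F (shift p.1.2 (-p.1.1) p.2) - F p.1.2 :=
  (hF.comp (Measurable.shift (by fun_prop) (by fun_prop) (by fun_prop))).sub
    (hF.comp (by fun_prop))

theorem measurable_removalMean (hF : Measurable F) (π : Kernel (Rd d × PathSpace T d) ℝ)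
    [IsMarkovKernel π] : Measurable fun p : Rd d × PathSpace T d => removalMean F π p.1 p.2 :=
  ((measurable_removal hF).stronglyMeasurable.integral_kernel_prod_right' (κ := π)).measurable

theorem abs_sub_le_two_mul (hC : ∀ w, |F w| ≤ C) (v w : PathSpace T d) : |F v - F w| ≤ 2 * C :=
  (abs_sub _ _).trans (by linarith [hC v, hC w])

theorem abs_removalMean_le (hC : ∀ w, |F w| ≤ C) (π : Kernel (Rd d × PathSpace T d) ℝ)
    [IsMarkovKernel π] (x : Rd d) (w : PathSpace T d) : |removalMean F π x w| ≤ 2 * C := by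
  have h := norm_integral_le_of_norm_le_const (μ := π (x, w))
    (f := fun t => F (shift w (-x) t) - F w) (C := 2 * C)
    (Eventually.of_forall fun t => abs_sub_le_two_mul hC _ _)
  simpa [removalMean] using h

theorem additionMean_eq (hF : Measurable F) (hC : ∀ w, |F w| ≤ C) (w : PathSpace T d) :
    additionMean ν F w
      = ∫ p, shiftDiff F (w, p) ∂(((volume : Measure ℝ).restrict (Icc 0 T)).prod ν) := by
  rw [integral_prod]
  · rfl
  · exact .of_bound (hF.shiftDiff.comp measurable_prodMk_left).aestronglyMeasurable (2 * C)
      (Eventually.of_forall fun _ => abs_sub_le_two_mul hC _ _)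

theorem measurable_additionMean (hF : Measurable F) (hC : ∀ w, |F w| ≤ C) :
    Measurable (additionMean ν F) := by
  rw [funext (additionMean_eq (ν := ν) hF hC)]
  exact hF.shiftDiff.stronglyMeasurable.integral_prod_right'.measurable

theorem abs_additionMean_le (hT : 0 < T) (hF : Measurable F) (hC : ∀ w, |F w| ≤ C)
    (w : PathSpace T d) : |additionMean ν F w| ≤ 2 * C * T := by
  rw [additionMean_eq hF hC]
  have h := norm_integral_le_of_norm_le_const
    (μ := ((volume : Measure ℝ).restrict (Icc 0 T)).prod ν)
    (f := fun p => shiftDiff F (w, p)) (C := 2 * C)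
    (Eventually.of_forall fun t => abs_sub_le_two_mul hC _ _)
  refine h.trans_eq ?_
  rw [measureReal_def, ← univ_prod_univ, Measure.prod_prod]
  simp [hT.le]

theorem integral_additionMean_mul (hF : Measurable F) (hC : ∀ w, |F w| ≤ C)
    {μ : Measure (PathSpace T d)} [IsProbabilityMeasure μ] {G : PathSpace T d → ℝ}
    (hGi : Integrable G μ) :
    Integrable (fun q => shiftDiff F q * G q.1) (baseMeasure ν μ) ∧
      ∫ q, shiftDiff F q * G q.1 ∂(baseMeasure ν μ) = ∫ w, additionMean ν F w * G w ∂μ := by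
  have hi : Integrable (fun q => shiftDiff F q * G q.1) (baseMeasure ν μ) :=
    (hGi.comp_fst _).bdd_mul hF.shiftDiff.aestronglyMeasurable
      (Eventually.of_forall fun _ => abs_sub_le_two_mul hC _ _)
  refine ⟨hi, ?_⟩
  rw [integral_prod _ hi]
  simp_rw [integral_mul_const, additionMean_eq hF hC]

/-- Conditioning on the shifted path and the size of the shift. -/
theorem integral_removalMean (hT : 0 < T) (hν : ν {0} = 0) (hF : Measurable F)
    (hC : ∀ w, |F w| ≤ C) {π : Kernel (Rd d × PathSpace T d) ℝ} [IsMarkovKernel π]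
    (hπ : HasCondDistrib (fun q : PathSpace T d × ℝ × Rd d => q.2.1)
      (fun q => (q.2.2, shift q.1 q.2.2 q.2.1)) π (canonicalLaw T ν))
    {G : PathSpace T d → ℝ} (hG : Measurable G) (hG2 : MemLp G 2 (poissonLaw T ν)) :
    ∫ q, shiftDiff F q * G (shift q.1 q.2.2 q.2.1) ∂(baseMeasure ν (poissonLaw T ν))
      = -∫ w, jumpSumReal (fun x => removalMean F π x w) w * G w ∂(poissonLaw T ν) := by
  have := isProbabilityMeasure_poissonLaw (ν := ν) hT
  have := isProbabilityMeasure_uniform hT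
  have hGi := integrable_shift hT hν hG hG2
  have hm : Measurable fun q : PathSpace T d × ℝ × Rd d =>
      (q.2.2, shift q.1 q.2.2 q.2.1) := Measurable.prodMk (by fun_prop) measurable_shift
  have hm' : Measurable fun q : PathSpace T d × ℝ × Rd d =>
      ((q.2.2, shift q.1 q.2.2 q.2.1), q.2.1) := hm.prodMk (by fun_prop)
  -- Evaluated at the shift size, the shifted path and the shift time, `Ψ` removes the jump just
  -- added, so it equals minus the difference of `F` times `G` at the shifted path. Averaging over
  -- the time with `π` gives `φ`.
  set Ψ : (Rd d × PathSpace T d) × ℝ → ℝ :=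
    fun p => (F (shift p.1.2 (-p.1.1) p.2) - F p.1.2) * G p.1.2 with hΨ
  have hΨm : Measurable Ψ := (measurable_removal hF).mul (hG.comp (by fun_prop))
  set φ : Rd d × PathSpace T d → ℝ := fun p => removalMean F π p.1 p.2 * G p.2 with hφ
  have hφm : Measurable φ := (measurable_removalMean hF π).mul (hG.comp measurable_snd)
  have hφi : Integrable (fun q : PathSpace T d × ℝ × Rd d => φ (q.2.2, shift q.1 q.2.2 q.2.1))
      (baseMeasure ν (poissonLaw T ν)) :=
    hGi.bdd_mul ((measurable_removalMean hF π).comp hm).aestronglyMeasurable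
      (Eventually.of_forall fun _ => abs_removalMean_le hC π _ _)
  have hΨi : Integrable (fun q : PathSpace T d × ℝ × Rd d =>
      Ψ ((q.2.2, shift q.1 q.2.2 q.2.1), q.2.1)) (baseMeasure ν (poissonLaw T ν)) :=
    hGi.bdd_mul ((measurable_removal hF).comp hm').aestronglyMeasurable
      (Eventually.of_forall fun _ => abs_sub_le_two_mul hC _ _)
  have hΨ' : ∀ q : PathSpace T d × ℝ × Rd d, Ψ ((q.2.2, shift q.1 q.2.2 q.2.1), q.2.1)
      = -(shiftDiff F q * G (shift q.1 q.2.2 q.2.1)) := by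
    intro q
    simp only [hΨ, shift_shift_neg, shiftDiff]
    ring
  have hmecke := (integral_jumpSumReal hT hν hφm hφi).2
  simp only [hφ, jumpSumReal_mul_const] at hmecke
  rw [hmecke]
  -- The reference measure is `T` times the canonical law, which disintegrates along `π`; `G`
  -- depends only on the conditioning variables and comes out of the inner integral.
  have hcond : ∫ q, Ψ ((q.2.2, shift q.1 q.2.2 q.2.1), q.2.1) ∂(baseMeasure ν (poissonLaw T ν))
      = ∫ q, φ (q.2.2, shift q.1 q.2.2 q.2.1) ∂(baseMeasure ν (poissonLaw T ν)) := by
    have hΨi' : Integrable Ψ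
        (((canonicalLaw T ν).map fun q => (q.2.2, shift q.1 q.2.2 q.2.1)) ⊗ₘ π) := by
      rw [← hπ.map_eq, integrable_map_measure hΨm.aestronglyMeasurable hm'.aemeasurable]
      rw [baseMeasure_eq hT, integrable_smul_measure (by simp [hT]) (by simp)] at hΨi
      exact hΨi
    rw [baseMeasure_eq hT, integral_smul_measure, integral_smul_measure,
      ← integral_map (φ := fun q : PathSpace T d × ℝ × Rd d =>
        ((q.2.2, shift q.1 q.2.2 q.2.1), q.2.1)) hm'.aemeasurable hΨm.aestronglyMeasurable,
      hπ.map_eq, Measure.integral_compProd hΨi',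
      ← integral_map (φ := fun q : PathSpace T d × ℝ × Rd d =>
        (q.2.2, shift q.1 q.2.2 q.2.1)) hm.aemeasurable hφm.aestronglyMeasurable]
    simp only [hΨ, integral_mul_const]
    rfl
  rw [← hcond, ← integral_neg]
  simp_rw [hΨ', neg_neg]

/-- The generator on a bounded measurable function. -/
def jumpGenerator (ν : Measure (Rd d)) (F : PathSpace T d → ℝ)
    (π : Kernel (Rd d × PathSpace T d) ℝ) (w : PathSpace T d) : ℝ :=
  T⁻¹ * additionMean ν F w + T⁻¹ * jumpSumReal (fun x => removalMean F π x w) w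

theorem memLp_jumpSumReal_removalMean (hT : 0 < T) (hν : ν {0} = 0) (hF : Measurable F)
    (hC : ∀ w, |F w| ≤ C) (π : Kernel (Rd d × PathSpace T d) ℝ) [IsMarkovKernel π] :
    MemLp (fun w => jumpSumReal (fun x => removalMean F π x w) w) 2 (poissonLaw T ν) := by
  refine ((memLp_jumpCount hT hν).const_mul (2 * C)).mono
    (aemeasurable_jumpSumReal hT hν (measurable_removalMean hF π)).aestronglyMeasurable ?_
  filter_upwards [ae_mem_stepSet_poissonLaw hT hν] with w hw
  exact (abs_jumpSumReal_le hT hw fun x => abs_removalMean_le hC π x w).trans (le_abs_self _)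

theorem memLp_additionMean (hT : 0 < T) (hF : Measurable F) (hC : ∀ w, |F w| ≤ C)
    (μ : Measure (PathSpace T d)) [IsProbabilityMeasure μ] : MemLp (additionMean ν F) 2 μ :=
  .of_bound (measurable_additionMean hF hC).aestronglyMeasurable (2 * C * T)
    (Eventually.of_forall fun w => abs_additionMean_le hT hF hC w)

theorem memLp_jumpGenerator (hT : 0 < T) (hν : ν {0} = 0) (hF : Measurable F)
    (hC : ∀ w, |F w| ≤ C) (π : Kernel (Rd d × PathSpace T d) ℝ) [IsMarkovKernel π] :
    MemLp (jumpGenerator ν F π) 2 (poissonLaw T ν) := by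
  have := isProbabilityMeasure_poissonLaw (ν := ν) hT
  exact ((memLp_additionMean hT hF hC _).const_mul T⁻¹).add
    ((memLp_jumpSumReal_removalMean hT hν hF hC π).const_mul T⁻¹)

/-- This is the integration by parts. The difference of `G` is split into its shifted and unshifted
values, which is legitimate because each product with the bounded difference of `F` is integrable.
-/
theorem jumpForm_eq_neg_integral (hT : 0 < T) (hν : ν {0} = 0) (hF : Measurable F)
    (hC : ∀ w, |F w| ≤ C) {π : Kernel (Rd d × PathSpace T d) ℝ} [IsMarkovKernel π]
    (hπ : HasCondDistrib (fun q : PathSpace T d × ℝ × Rd d => q.2.1)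
      (fun q => (q.2.2, shift q.1 q.2.2 q.2.1)) π (canonicalLaw T ν))
    {G : PathSpace T d → ℝ} (hG : Measurable G) (hG2 : MemLp G 2 (poissonLaw T ν))
    (hGD : MemLp (shiftDiff G) 2 (baseMeasure ν (poissonLaw T ν))) :
    jumpForm ν (poissonLaw T ν) F G = -∫ w, jumpGenerator ν F π w * G w ∂(poissonLaw T ν) := by
  have := isProbabilityMeasure_poissonLaw (ν := ν) hT
  have h1 := integral_removalMean hT hν hF hC hπ hG hG2
  obtain ⟨h2i, h2⟩ := integral_additionMean_mul (ν := ν) hF hC (hG2.integrable (by norm_num))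
  have h3i : Integrable (fun q => shiftDiff F q * G (shift q.1 q.2.2 q.2.1))
      (baseMeasure ν (poissonLaw T ν)) :=
    (integrable_shift hT hν hG hG2).bdd_mul hF.shiftDiff.aestronglyMeasurable
      (Eventually.of_forall fun _ => abs_sub_le_two_mul hC _ _)
  have h4 : ∀ w, jumpGenerator ν F π w * G w = T⁻¹ * (additionMean ν F w * G w
      + jumpSumReal (fun x => removalMean F π x w) w * G w) := fun w => by
    rw [jumpGenerator]
    ring
  have h5 : ∀ q : PathSpace T d × ℝ × Rd d, shiftDiff F q * shiftDiff G q
      = shiftDiff F q * G (shift q.1 q.2.2 q.2.1) - shiftDiff F q * G q.1 := fun q =>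
    mul_sub _ _ _
  rw [jumpForm_eq_integral (memLp_shiftDiff_of_bounded hF hC) hGD]
  simp_rw [h4, h5]
  have h6 : Integrable (fun w => additionMean ν F w * G w) (poissonLaw T ν) :=
    (memLp_additionMean hT hF hC _).integrable_mul hG2
  have h7 : Integrable (fun w => jumpSumReal (fun x => removalMean F π x w) w * G w)
      (poissonLaw T ν) :=
    (memLp_jumpSumReal_removalMean hT hν hF hC π).integrable_mul hG2
  rw [integral_sub h3i h2i, h1, h2, integral_const_mul, integral_add h6 h7]
  ring

theorem generator_jumpFormL2 (hT : 0 < T) (hν : ν {0} = 0) (hF : Measurable F)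
    (hC : ∀ w, |F w| ≤ C) {π : Kernel (Rd d × PathSpace T d) ℝ} [IsMarkovKernel π]
    (hπ : HasCondDistrib (fun q : PathSpace T d × ℝ × Rd d => q.2.1)
      (fun q => (q.2.2, shift q.1 q.2.2 q.2.1)) π (canonicalLaw T ν))
    (hF2 : MemLp F 2 (poissonLaw T ν)) :
    hF2.toLp F ∈ generatorDomain (poissonLaw T ν) (jumpDomain ν (poissonLaw T ν))
        (jumpFormL2 ν (poissonLaw T ν)) ∧
      generator (poissonLaw T ν) (jumpDomain ν (poissonLaw T ν))
        (jumpFormL2 ν (poissonLaw T ν)) (hF2.toLp F) =ᵐ[poissonLaw T ν] jumpGenerator ν F π := by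
  have := isProbabilityMeasure_poissonLaw (ν := ν) hT
  have hq := isNonsingularShift_poissonLaw hT hν
  have hH := memLp_jumpGenerator hT hν hF hC π
  obtain ⟨h1, h2⟩ := generator_eq_of_forall (E := jumpFormL2 ν (poissonLaw T ν))
    (dense_jumpDomain hT hq) (F := hF2.toLp F) (H := hH.toLp _)
    (hq.mem_jumpDomain_of_ae_eq hT hF2.coeFn_toLp (memLp_shiftDiff_of_bounded hF hC))
    fun G hG => by
      rw [jumpFormL2, hq.jumpForm_congr hF2.coeFn_toLp (ae_eq_refl G),
        jumpForm_eq_neg_integral hT hν hF hC hπ (measurable_coe_Lp G) (Lp.memLp G)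
          ((mem_jumpDomain_iff hT).1 hG), L2.inner_def]
      congr 1
      refine integral_congr_ae ?_
      filter_upwards [hH.coeFn_toLp] with w hw
      rw [hw]
      simp [mul_comm]
  exact ⟨h1, h2 ▸ hH.coeFn_toLp⟩

end Generator

/-! ### Jump laws carried by `ℤ^d` -/

section IntegerJumps

variable {T : ℝ} {d : ℕ} {ν : Measure (Rd d)} [IsProbabilityMeasure ν]

theorem intVec_injective : Function.Injective (intVec (d := d)) := by
  intro k l h
  funext i
  have := congrArg (fun x : Rd d => x i) h
  simpa [intVec] using this

/-- The coordinatewise integer part. -/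
def floorVec (x : Rd d) : Fin d → ℤ := fun i => ⌊x i⌋

theorem measurable_floorVec : Measurable (floorVec (d := d)) :=
  measurable_pi_lambda _ fun i => Int.measurable_floor.comp (by fun_prop)

@[simp]
theorem floorVec_intVec (k : Fin d → ℤ) : floorVec (intVec k) = k := by
  funext i
  simp [floorVec, intVec]

/-- A family of kernels indexed by `ℤ^d` as a kernel on `ℝ^d × M_T`. -/
def floorKernel (π : (Fin d → ℤ) → Kernel (PathSpace T d) ℝ) :
    Kernel (Rd d × PathSpace T d) ℝ where
  toFun p := π (floorVec p.1) p.2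
  measurable' := by
    have h : Measurable fun p : (Fin d → ℤ) × PathSpace T d => π p.1 p.2 :=
      measurable_from_prod_countable_right fun k => (π k).measurable
    exact h.comp ((measurable_floorVec.comp measurable_fst).prodMk measurable_snd)

theorem floorKernel_apply (π : (Fin d → ℤ) → Kernel (PathSpace T d) ℝ) (p : Rd d × PathSpace T d) :
    floorKernel π p = π (floorVec p.1) p.2 := rfl

instance (π : (Fin d → ℤ) → Kernel (PathSpace T d) ℝ) [∀ k, IsMarkovKernel (π k)] :
    IsMarkovKernel (floorKernel π) :=
  ⟨fun p => by rw [floorKernel_apply]; infer_instance⟩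

/-- The shift size is independent of the path and the time, so conditioning on the value `k` amounts
to replacing it by the constant `k`. Only points of `ℤ^d` are charged, and there `floorVec` inverts
`intVec`; the kernel's values elsewhere are irrelevant. -/
theorem hasCondDistrib_floorKernel (hT : 0 < T) (hZ : ν (range (intVec (d := d)))ᶜ = 0)
    {π : (Fin d → ℤ) → Kernel (PathSpace T d) ℝ} [∀ k, IsMarkovKernel (π k)]
    (hπ : ∀ k, HasCondDistrib (fun q : PathSpace T d × ℝ × Rd d => q.2.1)
      (fun q => shift q.1 (intVec k) q.2.1) (π k) (canonicalLaw T ν)) :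
    HasCondDistrib (fun q : PathSpace T d × ℝ × Rd d => q.2.1)
      (fun q => (q.2.2, shift q.1 q.2.2 q.2.1)) (floorKernel π) (canonicalLaw T ν) := by
  have := isProbabilityMeasure_poissonLaw (ν := ν) hT
  have := isProbabilityMeasure_uniform hT
  have hm : Measurable fun q : PathSpace T d × ℝ × Rd d =>
      (q.2.2, shift q.1 q.2.2 q.2.1) := Measurable.prodMk (by fun_prop) measurable_shift
  have hm' : Measurable fun q : PathSpace T d × ℝ × Rd d =>
      ((q.2.2, shift q.1 q.2.2 q.2.1), q.2.1) := hm.prodMk (by fun_prop)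
  have hassoc : ∀ g : PathSpace T d × ℝ × Rd d → ℝ≥0∞, Measurable g →
      ∫⁻ q, g q ∂(canonicalLaw T ν)
        = ∫⁻ x, ∫⁻ p, g (p.1, p.2, x) ∂((poissonLaw T ν).prod (unif T)) ∂ν := by
    intro g hg
    have hg' : Measurable fun r : (PathSpace T d × ℝ) × Rd d => g (r.1.1, r.1.2, r.2) :=
      hg.comp (by fun_prop)
    rw [← lintegral_prod_symm' _ hg', canonicalLaw,
      ← Measure.prodAssoc_prod, lintegral_map hg (by fun_prop)]
    rfl
  -- The hypothesis for a fixed `k` does not involve the shift size, which integrates out to total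
  -- mass one.
  have hk : ∀ k, ∀ f : PathSpace T d × ℝ → ℝ≥0∞, Measurable f →
      ∫⁻ p, f (shift p.1 (intVec k) p.2, p.2) ∂((poissonLaw T ν).prod (unif T))
        = ∫⁻ p, ∫⁻ s, f (shift p.1 (intVec k) p.2, s) ∂(π k (shift p.1 (intVec k) p.2))
          ∂((poissonLaw T ν).prod (unif T)) := by
    intro k f hf
    have hs : Measurable fun q : PathSpace T d × ℝ × Rd d => shift q.1 (intVec k) q.2.1 :=
      Measurable.shift (by fun_prop) measurable_const (by fun_prop)
    have hs' : Measurable fun p : PathSpace T d × ℝ => shift p.1 (intVec k) p.2 :=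
      Measurable.shift (by fun_prop) measurable_const (by fun_prop)
    have hf' : Measurable fun w => ∫⁻ s, f (w, s) ∂(π k w) := hf.lintegral_kernel_prod_right'
    have h := congrArg (fun m => ∫⁻ y, f y ∂m) (hπ k).map_eq
    simp only at h
    rw [lintegral_map hf (hs.prodMk (by fun_prop)), Measure.lintegral_compProd hf,
      lintegral_map hf' hs,
      hassoc (fun q => f (shift q.1 (intVec k) q.2.1, q.2.1)) (hf.comp (hs.prodMk (by fun_prop))),
      hassoc (fun q => ∫⁻ s, f (shift q.1 (intVec k) q.2.1, s) ∂(π k (shift q.1 (intVec k) q.2.1)))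
        (hf'.comp hs)] at h
    simpa using h
  refine ⟨hm'.aemeasurable, Measure.ext_of_lintegral _ fun f hf => ?_⟩
  have hfk : Measurable fun p => ∫⁻ s, f (p, s) ∂(floorKernel π p) :=
    hf.lintegral_kernel_prod_right'
  rw [lintegral_map hf hm', Measure.lintegral_compProd hf, lintegral_map hfk hm,
    hassoc (fun q => f ((q.2.2, shift q.1 q.2.2 q.2.1), q.2.1)) (hf.comp hm'),
    hassoc (fun q => ∫⁻ s, f ((q.2.2, shift q.1 q.2.2 q.2.1), s)
      ∂(floorKernel π (q.2.2, shift q.1 q.2.2 q.2.1))) (hfk.comp hm)]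
  refine lintegral_congr_ae ?_
  have hae : ∀ᵐ x ∂ν, x ∈ range (intVec (d := d)) := by
    rw [ae_iff]
    exact hZ
  filter_upwards [hae] with x hx
  obtain ⟨k, rfl⟩ := hx
  have := hk k (fun p => f ((intVec k, p.1), p.2)) (hf.comp (by fun_prop))
  simpa [floorKernel_apply] using this

/-- Mecke's formula for the indicator of the complement of `ℤ^d` shows that the expected number of
such jumps is zero. -/
theorem ae_jumpCountOf_eq_zero (hT : 0 < T) (hν : ν {0} = 0)
    (hZ : ν (range (intVec (d := d)))ᶜ = 0) :
    ∀ᵐ w ∂(poissonLaw T ν), ∀ x ∉ range (intVec (d := d)), (jumpCountOf x w).toReal = 0 := by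
  have := isProbabilityMeasure_poissonLaw (ν := ν) hT
  have hR : MeasurableSet (range (intVec (d := d))) := (countable_range _).measurableSet
  have hf : Measurable fun p : Rd d × PathSpace T d =>
      (range (intVec (d := d)))ᶜ.indicator (1 : Rd d → ℝ≥0∞) p.1 :=
    (measurable_one.indicator hR.compl).comp measurable_fst
  have h := lintegral_jumpSum_poissonLaw hT hν hf
  have h0 : ∀ᵐ q ∂(baseMeasure ν (poissonLaw T ν)),
      (range (intVec (d := d)))ᶜ.indicator (1 : Rd d → ℝ≥0∞) q.2.2 = 0 := by
    have hae : ∀ᵐ x ∂ν, (range (intVec (d := d)))ᶜ.indicator (1 : Rd d → ℝ≥0∞) x = 0 := by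
      filter_upwards [measure_eq_zero_iff_ae_notMem.1 hZ] with x hx using indicator_of_notMem hx _
    exact (Measure.quasiMeasurePreserving_snd.comp Measure.quasiMeasurePreserving_snd).ae hae
  rw [lintegral_congr_ae h0, lintegral_zero,
    lintegral_eq_zero_iff' (aemeasurable_jumpSum hT (ae_mem_stepSet_poissonLaw hT hν) hf)] at h
  filter_upwards [h] with w hw x hx
  have := ENNReal.tsum_eq_zero.1 hw x
  dsimp only at this
  rw [indicator_of_mem (mem_compl hx), Pi.one_apply, mul_one, ENNReal.ofReal_eq_zero] at this
  exact le_antisymm this ENNReal.toReal_nonneg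

/-- An integral with respect to a measure carried by `ℤ^d` is a sum. -/
theorem hasSum_integral_intVec {ν : Measure (Rd d)} (hZ : ν (range (intVec (d := d)))ᶜ = 0)
    {f : Rd d → ℝ}
    (hf : Integrable f ν) :
    HasSum (fun k : Fin d → ℤ => ν.real {intVec k} * f (intVec k)) (∫ x, f x ∂ν) := by
  have hR : MeasurableSet (range (intVec (d := d))) := (countable_range _).measurableSet
  have hdisj : Pairwise (Function.onFun Disjoint fun k : Fin d → ℤ => ({intVec k} : Set (Rd d))) :=
    fun k l hkl => disjoint_singleton.2 (intVec_injective.ne hkl)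
  have h := hasSum_integral_iUnion (f := f) (μ := ν) (fun k : Fin d → ℤ =>
    measurableSet_singleton (intVec k)) hdisj hf.integrableOn
  rw [iUnion_singleton_eq_range, setIntegral_eq_integral_of_ae_compl_eq_zero] at h
  · simpa only [integral_singleton, smul_eq_mul] using h
  · filter_upwards [measure_eq_zero_iff_ae_notMem.1 hZ] with x hx hx'
    exact absurd hx' hx

end IntegerJumps

/-! ### Transfer to the canonical law and the final assembly -/

section Transfer

/-- A conditional distribution depends only on the joint law, so conditioning on the original space
can be read on the canonical one. -/
theorem ProbabilityTheory.HasCondDistrib.of_comp {Ω α β γ : Type*} [MeasurableSpace Ω]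
    [MeasurableSpace α] [MeasurableSpace β] [MeasurableSpace γ] {P : Measure Ω} {Y : Ω → α} (hY : Measurable Y)
    {f : α → β} {g : α → γ} (hf : Measurable f) (hg : Measurable g) {κ : Kernel γ β}
    (h : HasCondDistrib (fun a => f (Y a)) (fun a => g (Y a)) κ P) :
    HasCondDistrib f g κ (P.map Y) := by
  refine ⟨(hg.prodMk hf).aemeasurable, ?_⟩
  rw [Measure.map_map (hg.prodMk hf) hY, Measure.map_map hg hY]
  exact h.map_eq

variable {T : ℝ} {d : ℕ} {ν : Measure (Rd d)} [IsProbabilityMeasure ν]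

theorem map_eq_canonicalLaw {Ω : Type*} [MeasurableSpace Ω] {P : Measure Ω}
    [IsProbabilityMeasure P] (hT : 0 < T) (hν : ν {0} = 0) {X : Ω → PathSpace T d} {τ : Ω → ℝ}
    {ξ : Ω → Rd d} (hX : IsPoissonProcess X ν P) (hτm : Measurable τ)
    (hτ : P.map τ = unif T) (hξm : Measurable ξ) (hξ : P.map ξ = ν)
    (hind : IndepFun X (fun a => (τ a, ξ a)) P) (hind' : IndepFun τ ξ P) :
    P.map (fun a => (X a, τ a, ξ a)) = canonicalLaw T ν := by
  rw [(indepFun_iff_map_prod_eq_prod_map_map hX.measurable.aemeasurable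
      (hτm.prodMk hξm).aemeasurable).1 hind,
    (indepFun_iff_map_prod_eq_prod_map_map hτm.aemeasurable hξm.aemeasurable).1 hind',
    hX.map_eq_stepMeasure hT hν, hτ, hξ]

theorem exists_hasCondDistrib_shift (hT : 0 < T) :
    ∃ π : Kernel (Rd d × PathSpace T d) ℝ, IsMarkovKernel π ∧
      HasCondDistrib (fun q : PathSpace T d × ℝ × Rd d => q.2.1)
        (fun q => (q.2.2, shift q.1 q.2.2 q.2.1)) π (canonicalLaw T ν) := by
  have := isProbabilityMeasure_poissonLaw (ν := ν) hT
  have := isProbabilityMeasure_uniform hT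
  have : IsProbabilityMeasure (canonicalLaw T ν) := by infer_instance
  have hm : Measurable fun q : PathSpace T d × ℝ × Rd d =>
      (q.2.2, shift q.1 q.2.2 q.2.1) := Measurable.prodMk (by fun_prop) measurable_shift
  have ht : Measurable fun q : PathSpace T d × ℝ × Rd d => q.2.1 := by fun_prop
  exact ⟨condDistrib _ _ (canonicalLaw T ν), inferInstance, (hm.prodMk ht).aemeasurable,
    (compProd_map_condDistrib ht.aemeasurable).symm⟩

theorem jumpGenerator_eq_tsum {ν : Measure (Rd d)} (F : PathSpace T d → ℝ)
    (π : Kernel (Rd d × PathSpace T d) ℝ)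
    (w : PathSpace T d) :
    jumpGenerator ν F π w = T⁻¹ * additionMean ν F w
      + ∑' x, (jumpCountOf x w).toReal / T * removalMean F π x w := by
  rw [jumpGenerator, jumpSumReal, ← tsum_mul_left]
  congr 1
  refine tsum_congr fun x => ?_
  ring

theorem summable_jump_div (hT : 0 < T) {w : PathSpace T d} (hw : w ∈ stepSet T d)
    (f : Rd d → ℝ) : Summable fun x => (jumpCountOf x w).toReal / T * f x := by
  refine ((summable_jump hT hw f).mul_left T⁻¹).congr fun x => ?_
  ring

theorem hasSum_additionMean_intVec (hZ : ν (range (intVec (d := d)))ᶜ = 0)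
    {F : PathSpace T d → ℝ} (hF : Measurable F) {C : ℝ} (hC : ∀ w, |F w| ≤ C)
    (w : PathSpace T d) :
    HasSum (fun k : Fin d → ℤ => ν.real {intVec k} / T *
      ∫ t in Icc (0 : ℝ) T, (F (shift w (intVec k) t) - F w)) (T⁻¹ * additionMean ν F w) := by
  have hi : Integrable (fun p : ℝ × Rd d => F (shift w p.2 p.1) - F w)
      (((volume : Measure ℝ).restrict (Icc 0 T)).prod ν) :=
    .of_bound (hF.shiftDiff.comp measurable_prodMk_left).aestronglyMeasurable (2 * C)
      (Eventually.of_forall fun _ => abs_sub_le_two_mul hC _ _)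
  have h := (hasSum_integral_intVec hZ hi.integral_prod_right).mul_left T⁻¹
  rw [← integral_integral_swap hi] at h
  refine h.congr_fun fun k => ?_
  ring

end Transfer

end

theorem theorem2p2 {Ω : Type*} [MeasurableSpace Ω] (P : Measure Ω) [IsProbabilityMeasure P]
    (T : ℝ) (hT : 0 < T) (d : ℕ)
    (ν : Measure (Rd d)) [IsProbabilityMeasure ν] (hν : ν {0} = 0)
    (X : Ω → PathSpace T d) (τ : Ω → ℝ) (ξ : Ω → Rd d)
    (hX : IsPoissonProcess X ν P)
    (hτm : Measurable τ) (hτ : pdf.IsUniform τ (Icc 0 T) P)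
    (hξm : Measurable ξ) (hξ : P.map ξ = ν)
    -- the three variables `X`, `τ`, `ξ` are independent
    (hind : IndepFun X (fun a => (τ a, ξ a)) P) (hind' : IndepFun τ ξ P)
    (μ : Measure (PathSpace T d)) (hμ : μ = P.map X) :
    -- quasi-invariance and the density
    (P.map (fun a => shift (X a) (ξ a) (τ a)) ≪ μ ∧
      AEMeasurable (jumpCount (T := T) (d := d)) μ ∧
      P.map (fun a => shift (X a) (ξ a) (τ a))
        = μ.withDensity (fun w => jumpCount w / ENNReal.ofReal T)) ∧
    -- `ℰ` does not depend on `μ`-versions, and is given by an absolutely convergent integral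
    (∀ F F' G G' : PathSpace T d → ℝ, F =ᵐ[μ] F' → G =ᵐ[μ] G' →
      energy ν μ F = energy ν μ F' ∧ jumpForm ν μ F G = jumpForm ν μ F' G') ∧
    (∀ F ∈ jumpDomain ν μ, ∀ G ∈ jumpDomain ν μ,
      Integrable (fun p : PathSpace T d × ℝ × Rd d => Gam p.2.1 p.2.2 F G p.1)
        (μ.prod ((volume.restrict (Icc 0 T)).prod ν))) ∧
    -- it is a conservative symmetric Dirichlet form
    IsSymmetricDirichletForm μ (jumpDomain ν μ) (jumpFormL2 ν μ) ∧
    IsConservativeForm μ (jumpDomain ν μ) (jumpFormL2 ν μ) ∧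
    -- the generator on bounded measurable functions
    (∀ F : PathSpace T d → ℝ, Measurable F → (∃ C, ∀ w, |F w| ≤ C) →
      ∃ hF : MemLp F 2 μ,
        hF.toLp F ∈ generatorDomain μ (jumpDomain ν μ) (jumpFormL2 ν μ) ∧
        -- `π (x, ·)` is the conditional law of `τ` given `X + x 1_{[τ,T]}`, jointly in `x`
        (∀ π : Kernel (Rd d × PathSpace T d) ℝ, IsMarkovKernel π →
          HasCondDistrib τ (fun a => (ξ a, shift (X a) (ξ a) (τ a))) π P →
          ∀ᵐ w ∂μ,
            Summable (fun x : Rd d => (jumpCountOf x w).toReal / T *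
              ∫ t, (F (shift w (-x) t) - F w) ∂(π (x, w))) ∧
            generator μ (jumpDomain ν μ) (jumpFormL2 ν μ) (hF.toLp F) w =
              T⁻¹ * (∫ t in Icc (0 : ℝ) T, ∫ x, (F (shift w x t) - F w) ∂ν) +
              ∑' x : Rd d, (jumpCountOf x w).toReal / T *
                ∫ t, (F (shift w (-x) t) - F w) ∂(π (x, w))) ∧
        -- the case where `ν` is supported on `ℤ^d`
        (ν (range (intVec (d := d)))ᶜ = 0 →
          ∀ π : (Fin d → ℤ) → Kernel (PathSpace T d) ℝ, (∀ k, IsMarkovKernel (π k)) →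
          (∀ k, HasCondDistrib τ (fun a => shift (X a) (intVec k) (τ a)) (π k) P) →
          ∀ᵐ w ∂μ,
            Summable (fun k : Fin d → ℤ => ν.real {intVec k} / T *
              ∫ t in Icc (0 : ℝ) T, (F (shift w (intVec k) t) - F w)) ∧
            Summable (fun k : Fin d → ℤ => (jumpCountOf (intVec k) w).toReal / T *
              ∫ t, (F (shift w (-intVec k) t) - F w) ∂(π k w)) ∧
            generator μ (jumpDomain ν μ) (jumpFormL2 ν μ) (hF.toLp F) w =
              (∑' k : Fin d → ℤ, ν.real {intVec k} / T *
                ∫ t in Icc (0 : ℝ) T, (F (shift w (intVec k) t) - F w)) +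
              ∑' k : Fin d → ℤ, (jumpCountOf (intVec k) w).toReal / T *
                ∫ t, (F (shift w (-intVec k) t) - F w) ∂(π k w))) := by
  have hlaw := map_eq_canonicalLaw hT hν hX hτm hτ hξm hξ hind hind'
  have hY : Measurable fun a => (X a, τ a, ξ a) := hX.measurable.prodMk (hτm.prodMk hξm)
  obtain rfl : μ = poissonLaw T ν := hμ.trans (hX.map_eq_stepMeasure hT hν)
  clear hμ
  have hprob := isProbabilityMeasure_poissonLaw (ν := ν) hT
  have hq := isNonsingularShift_poissonLaw (d := d) hT hν
  have hshift : P.map (fun a => shift (X a) (ξ a) (τ a))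
      = (poissonLaw T ν).withDensity fun w => jumpCount w / ENNReal.ofReal T := by
    rw [← map_shift_eq_withDensity hT hν, ← hlaw, Measure.map_map measurable_shift hY]
    rfl
  refine ⟨⟨hshift ▸ withDensity_absolutelyContinuous _ _, aemeasurable_jumpCount hT hν, hshift⟩,
    fun F F' G G' hF hG => ⟨hq.energy_congr hF, hq.jumpForm_congr hF hG⟩,
    fun F hF G hG => integrable_shiftDiff_mul ((mem_jumpDomain_iff hT).1 hF)
      ((mem_jumpDomain_iff hT).1 hG),
    isSymmetricDirichletForm_jumpFormL2 hT hq, isConservativeForm_jumpFormL2 hT hq,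
    fun F hF ⟨C, hC⟩ => ?_⟩
  have hF2 : MemLp F 2 (poissonLaw T ν) :=
    .of_bound hF.aestronglyMeasurable C (Eventually.of_forall hC)
  -- Membership in the generator domain must hold without a given kernel, so some regular
  -- conditional distribution is chosen for it.
  obtain ⟨π₀, _, hπ₀⟩ := exists_hasCondDistrib_shift (ν := ν) hT
  refine ⟨hF2, (generator_jumpFormL2 hT hν hF hC hπ₀ hF2).1,
    fun π _ hπ => ?_, fun hZ π _ hπ => ?_⟩
  · have hπ' := HasCondDistrib.of_comp hY (f := fun q => q.2.1)
      (g := fun q => (q.2.2, shift q.1 q.2.2 q.2.1)) (by fun_prop)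
      (Measurable.prodMk (by fun_prop) measurable_shift) hπ
    rw [hlaw] at hπ'
    filter_upwards [ae_mem_stepSet_poissonLaw hT hν,
      (generator_jumpFormL2 hT hν hF hC hπ' hF2).2] with w hw hgen
    exact ⟨summable_jump_div hT hw _, hgen.trans (jumpGenerator_eq_tsum F π w)⟩
  · have hπ' : ∀ k, HasCondDistrib (fun q : PathSpace T d × ℝ × Rd d => q.2.1)
        (fun q => shift q.1 (intVec k) q.2.1) (π k) (canonicalLaw T ν) := fun k => by
      have h := HasCondDistrib.of_comp hY (f := fun q => q.2.1)
        (g := fun q => shift q.1 (intVec k) q.2.1) (by fun_prop)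
        (Measurable.shift (by fun_prop) measurable_const (by fun_prop)) (hπ k)
      rwa [hlaw] at h
    filter_upwards [ae_mem_stepSet_poissonLaw hT hν, ae_jumpCountOf_eq_zero hT hν hZ,
      (generator_jumpFormL2 hT hν hF hC (hasCondDistrib_floorKernel hT hZ hπ') hF2).2]
      with w hw hzero hgen
    have hadd := hasSum_additionMean_intVec hZ hF hC w
    have hrem : ∀ k : Fin d → ℤ, removalMean F (floorKernel π) (intVec k) w
        = ∫ t, (F (shift w (-intVec k) t) - F w) ∂(π k w) := fun k => by
      rw [removalMean, floorKernel_apply, floorVec_intVec]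
    have hsum := summable_jump_div hT hw fun x => removalMean F (floorKernel π) x w
    -- The sum over `ℝ^d` lives on `ℤ^d` and is re-indexed by `k`. The index `k = 0` may be kept:
    -- its infinite count becomes `0` under `toReal`.
    have hsupp : (Function.support fun x => (jumpCountOf x w).toReal / T *
        removalMean F (floorKernel π) x w) ⊆ range (intVec (d := d)) := by
      intro x hx
      by_contra hx'
      exact hx (by simp [hzero x hx'])
    refine ⟨hadd.summable, ?_, ?_⟩
    · simpa only [Function.comp_def, hrem] using hsum.comp_injective intVec_injective
    · rw [hgen, jumpGenerator_eq_tsum, hadd.tsum_eq, ← intVec_injective.tsum_eq hsupp]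
      simp_rw [hrem]
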